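/- **Setting.** Let $n_x,n_u\ge 1$, $f:\mathbb R^{n_x}\times\mathbb R^{n_u}\to\mathbb R^{n_x}$, $\ell:\mathbb R^{n_x}\times\mathbb R^{n_u}\to[0,\infty)$, and let $\mathcal U(x)\subseteq\mathbb R^{n_u}$ be a non-empty set for each $x$. For the system $x(k+1)=f(x(k),u(k))$, an input sequence is admissible if $u(k)\in\mathcal U(x(k))$ for all $k$; $J(x,\mathbf u)=\sum_{k\ge0}\ell(x(k),u(k))\in[0,\infty]$ is its cost from $x(0)=x$, and $V^\star(x)$ is the infimum of $J(x,\cdot)$ over admissible sequences. For a feedback law $h$, $\phi(k,x,h)$ is the closed-loop solution at time $k$ from $x$, and $J(x,h)$ its cost. Write $h\in S$ when $h(x)\in S(x)$ for all $x$. Let $H^\star(x)=\operatorname{argmin}_{u\in\mathcal U(x)}\{\ell(x,u)+V^\star(f(x,u))\}$. *PI$^+$.* Given $h^0\in\mathcal U$, put $H_r^0(x)=\{h^0(x)\}$, $V_r^0=J(\cdot,h^0)$ and, for $i\ge 0$, $$H^{i+1}(x)=\operatorname*{argmin}_{u\in\mathcal U(x)}\{\ell(x,u)+V_r^i(f(x,u))\},\quad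 H_r^{i+1}(x)=\bigcap_{\delta>0}\overline{H^{i+1}(x+\delta\mathbb B)},\quad V_r^{i+1}(x)=\min_{h\in H_r^{i+1}}J(x,h),$$ where $\mathbb B$ is the closed unit ball. *Standing assumptions.* $\sigma:\mathbb R^{n_x}\to[0,\infty)$ is continuous, and: (1) for every $x$ there is an admissible sequence of finite and minimal cost from $x$; (2) there are a continuous $W:\mathbb R^{n_x}\to[0,\infty)$, $\alpha_W,\chi_W\in\mathcal K_\infty$ and a continuous nondecreasing $\overline\alpha_W:[0,\infty)\to[0,\infty)$ with $\overline\alpha_W(0)=0$ such that $W(x)\le\overline\alpha_W(\sigma(x))$ and $W(f(x,u))-W(x)\le-\alpha_W(\sigma(x))+\chi_W(\ell(x,u))$ whenever $u\in\mathcal U(x)$; (3) there is $\overline\alpha_V\in\mathcal K_\infty$ with $J(x,h^0)\le\overline\alpha_V(\sigma(x))$ for all $x$. *Feasibility assumption.* (i) $f$ and $\ell$ are continuous; (ii) $\ell$ is level-bounded in $u\in\mathcal U(x)$, locally uniformly in $x$: for all $x$ and $a\in\mathbb R$ there are a neighbourhood $S$ of $x$ and a bounded $B\subset\mathbb R^{n_u}$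 with $\{u\in\mathcal U(z):\ell(z,u)\le a\}\subseteq B$ for all $z\in S$; (iii) $\mathcal U$ is outer semicontinuous; (iv) $J(\cdot,h^0)$ is lower semicontinuous; (v) $\{\sigma\le\Delta\}$ is compact for every $\Delta>0$. *Functions.* Given $\underline\alpha_Y,\alpha_Y,\overline\alpha_Y$, let $\widetilde\alpha_Y=\alpha_Y\circ\overline\alpha_Y^{-1}$ and $$\beta(s,k)=\underline\alpha_Y^{-1}\Big(\max_{t\in[0,\overline\alpha_Y(s)]}(\mathbb I-\widetilde\alpha_Y)^{(k)}(t)\Big)$$ ($\mathbb I$ is the identity, $(k)$ denotes $k$-fold composition; if $\mathbb I-\widetilde\alpha_Y$ is nondecreasing, then $\beta(s,k)=\underline\alpha_Y^{-1}\circ(\mathbb I-\widetilde\alpha_Y)^{(k)}\circ\overline\alpha_Y(s)$). Given $\widehat\alpha$, let $\widetilde\alpha(s)=\max_{t\in[0,s]}\widehat\alpha(t)$. (G) General case: with $q_V=2\chi_W(2\mathbb I)$, $q_W=\frac12[\chi_W+(\overline\alpha_W+\mathbb I)\circ\alpha_W^{-1}(2\chi_W)]^{-1}$ (inverse function), $\rho_V(s)=\int_0^sq_V$,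 $\rho_W(s)=\int_0^sq_W$: $\alpha_Y=q_W(\frac14\alpha_W)\,\frac14\alpha_W$, $\overline\alpha_Y=\rho_V\circ\overline\alpha_V+\rho_W\circ\overline\alpha_W$, $\underline\alpha_Y=\min\{\rho_V\circ\chi_W^{-1}(\frac12\alpha_W),\rho_W(\frac12\alpha_W)\}$, $\widehat\alpha=\overline\alpha_V-\chi_W^{-1}(\max\{0,\alpha_W-\overline\alpha_W\})$. (S) If $\chi_W\le\mathbb I$: $\alpha_Y=\underline\alpha_Y=\alpha_W$, $\overline\alpha_Y=\overline\alpha_V+\overline\alpha_W$, $\widehat\alpha=\min\{\overline\alpha_V,\overline\alpha_Y-\underline\alpha_Y\}$. (E) If $\chi_W(s)\le c_Ws$, $\alpha_W(s)\ge a_Ws$, $\overline\alpha_V(s)\le\overline a_Vs$, $\overline\alpha_W(s)\le\overline a_Ws$ for all $s\ge0$, with $c_W,a_W,\overline a_V>0$, $\overline a_W\ge0$: with $a_Y=a_W/c_W$ and $\overline a_Y=\overline a_V+\overline a_W/c_W$, put $\beta(s,k)=\frac{\overline a_Y}{a_Y}\big(1-\frac{a_Y}{\overline a_Y}\big)^ks$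 and $\widetilde\alpha(s)=\min\{\overline a_V,\overline a_Y-a_Y\}\,s$. **Theorem (near-optimality of PI$^+$).** Under these assumptions, each $V_r^i(x)$ is finite and the minimum defining it is attained. For every $h^\star\in H^\star$, $i\ge0$ and $x\in\mathbb R^{n_x}$, $$(V_r^i-V^\star)(x)\le(V_r^0-V^\star)(\phi(i,x,h^\star)).$$ Moreover, with $(\beta,\widetilde\alpha)$ as in (G), as in (S) if $\chi_W\le\mathbb I$, and as in (E) under the linear bounds stated there, for all $i\ge0$ and $x\in\mathbb R^{n_x}$, $$V_r^i(x)-V^\star(x)\le\widetilde\alpha(\beta(\sigma(x),i)).$$ Here $\beta\in\mathcal{KL}$, that is, $\beta\ge 0$ is nondecreasing in $s$, nonincreasing in $k\in\mathbb Z_{\ge0}$, and tends to $0$ as $s\to0^+$ for each $k$ and as $k\to\infty$ for each $s$. The function $\widetilde\alpha$ is continuous, nondecreasing and zero at zero, and it is positive definite unless $V^\star=\overline\alpha_V\circ\sigma$ on some sublevel set $\{\sigma\le s\}$ with $s>0$. -/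

import Mathlib

open Set Filter Topology
open scoped NNReal ENNReal

/-- Data of a deterministic discrete-time optimal control problem: the dynamics
`x(k+1) = f (x(k), u(k))`, the nonnegative stage cost `ℓ`, and the non-empty sets `U x` of inputs
that are admissible at the state `x`. -/
structure ControlProblem (n m : ℕ) where
  f : EuclideanSpace ℝ (Fin n) → EuclideanSpace ℝ (Fin m) → EuclideanSpace ℝ (Fin n)
  ℓ : EuclideanSpace ℝ (Fin n) → EuclideanSpace ℝ (Fin m) → ℝ≥0
  U : EuclideanSpace ℝ (Fin n) → Set (EuclideanSpace ℝ (Fin m))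
  U_nonempty : ∀ x, (U x).Nonempty

/-- `h` is a selection of the set-valued map `S`. -/
def IsSelection {X Y : Type*} (S : X → Set Y) (h : X → Y) : Prop :=
  ∀ x, h x ∈ S x

/-- The minimizers of `g` over `S`. -/
def argminOn {Y : Type*} (S : Set Y) (g : Y → ℝ≥0∞) : Set Y :=
  {u | u ∈ S ∧ ∀ v ∈ S, g u ≤ g v}

namespace ControlProblem

variable {n m : ℕ} (P : ControlProblem n m)

/-- `φ(k, x, u)`: the solution at time `k`, from `x`, for the input sequence `u`. -/
def traj (x : EuclideanSpace ℝ (Fin n)) (u : ℕ → EuclideanSpace ℝ (Fin m)) :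
    ℕ → EuclideanSpace ℝ (Fin n)
  | 0 => x
  | k + 1 => P.f (traj x u k) (u k)

/-- The input sequence `u` is admissible from `x`. -/
def Admissible (x : EuclideanSpace ℝ (Fin n)) (u : ℕ → EuclideanSpace ℝ (Fin m)) : Prop :=
  ∀ k, u k ∈ P.U (P.traj x u k)

/-- The infinite-horizon cost `J(x, u)`, possibly `∞`. -/
noncomputable def cost (x : EuclideanSpace ℝ (Fin n)) (u : ℕ → EuclideanSpace ℝ (Fin m)) : ℝ≥0∞ :=
  ∑' k, (P.ℓ (P.traj x u k) (u k) : ℝ≥0∞)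

/-- `φ(k, x, h)`: the solution at time `k`, from `x`, in closed loop with the feedback law `h`. -/
def closedLoop (h : EuclideanSpace ℝ (Fin n) → EuclideanSpace ℝ (Fin m))
    (x : EuclideanSpace ℝ (Fin n)) : ℕ → EuclideanSpace ℝ (Fin n)
  | 0 => x
  | k + 1 => P.f (closedLoop h x k) (h (closedLoop h x k))

/-- The cost `J(x, h)` induced by the feedback law `h`, possibly `∞`. -/
noncomputable def policyCost (h : EuclideanSpace ℝ (Fin n) → EuclideanSpace ℝ (Fin m))
    (x : EuclideanSpace ℝ (Fin n)) : ℝ≥0∞ :=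
  ∑' k, (P.ℓ (P.closedLoop h x k) (h (P.closedLoop h x k)) : ℝ≥0∞)

/-- The optimal value function `V⋆`. -/
noncomputable def optValue (x : EuclideanSpace ℝ (Fin n)) : ℝ≥0∞ :=
  ⨅ u ∈ {u : ℕ → EuclideanSpace ℝ (Fin m) | P.Admissible x u}, P.cost x u

/-- `x ↦ argmin_{u ∈ U x} { ℓ(x, u) + V(f(x, u)) }`. -/
noncomputable def improve (V : EuclideanSpace ℝ (Fin n) → ℝ≥0∞) (x : EuclideanSpace ℝ (Fin n)) :
    Set (EuclideanSpace ℝ (Fin m)) :=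
  argminOn (P.U x) fun u => (P.ℓ x u : ℝ≥0∞) + V (P.f x u)

/-- The set-valued map `H⋆` of optimal inputs. -/
noncomputable def optInputs : EuclideanSpace ℝ (Fin n) → Set (EuclideanSpace ℝ (Fin m)) :=
  P.improve P.optValue

/-- The outer semicontinuous regularization `x ↦ ⋂_{δ > 0} closure (H (x + δ 𝔹))`. -/
def regularize (H : EuclideanSpace ℝ (Fin n) → Set (EuclideanSpace ℝ (Fin m)))
    (x : EuclideanSpace ℝ (Fin n)) : Set (EuclideanSpace ℝ (Fin m)) :=
  ⋂ δ > (0 : ℝ), closure (⋃ y ∈ Metric.closedBall x δ, H y)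

/-- The infimum over all selections `h` of `H` of the induced cost `J(x, h)`. -/
noncomputable def bestCost (H : EuclideanSpace ℝ (Fin n) → Set (EuclideanSpace ℝ (Fin m)))
    (x : EuclideanSpace ℝ (Fin n)) : ℝ≥0∞ :=
  ⨅ h ∈ {h : EuclideanSpace ℝ (Fin n) → EuclideanSpace ℝ (Fin m) | IsSelection H h},
    P.policyCost h x

/-- The value functions `V_r^i` of PI⁺ started from the policy `h0`. -/
noncomputable def plusValue (h0 : EuclideanSpace ℝ (Fin n) → EuclideanSpace ℝ (Fin m)) :
    ℕ → EuclideanSpace ℝ (Fin n) → ℝ≥0∞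
  | 0 => P.policyCost h0
  | i + 1 => P.bestCost (regularize (P.improve (plusValue h0 i)))

/-- The regularized policy maps `H_r^i` of PI⁺ started from the policy `h0`. -/
noncomputable def plusInputs (h0 : EuclideanSpace ℝ (Fin n) → EuclideanSpace ℝ (Fin m)) :
    ℕ → EuclideanSpace ℝ (Fin n) → Set (EuclideanSpace ℝ (Fin m))
  | 0 => fun x => {h0 x}
  | i + 1 => regularize (P.improve (P.plusValue h0 i))

end ControlProblem

/-! ### Comparison functions

Functions on `[0, ∞)` are represented by functions `ℝ → ℝ` that are only evaluated on `[0, ∞)`. -/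

/-- Class `K_∞`. -/
structure IsClassKInf (α : ℝ → ℝ) : Prop where
  continuousOn : ContinuousOn α (Ici 0)
  strictMonoOn : StrictMonoOn α (Ici 0)
  map_zero : α 0 = 0
  tendsto_atTop : Tendsto α atTop atTop

/-- Class `KL` (time being discrete): nondecreasing in `s`, nonincreasing in `k`, with limit `0` as
`s → 0⁺` for each `k`, and as `k → ∞` for each `s`. -/
structure IsClassKL (β : ℝ → ℕ → ℝ) : Prop where
  nonneg : ∀ s, 0 ≤ s → ∀ k, 0 ≤ β s k
  monotoneOn : ∀ k, MonotoneOn (fun s => β s k) (Ici 0)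
  antitone : ∀ s, 0 ≤ s → Antitone (β s)
  tendsto_zero : ∀ k, Tendsto (fun s => β s k) (𝓝[>] 0) (𝓝 0)
  tendsto_atTop : ∀ s, 0 ≤ s → Tendsto (β s) atTop (𝓝 0)

/-- The inverse on `[0, ∞)` of a function of class `K_∞`. -/
noncomputable def kinv (α : ℝ → ℝ) : ℝ → ℝ :=
  Function.invFunOn α (Ici 0)

/-- `s ↦ max_{t ∈ [0, s]} g t` (for `g` continuous on `[0, ∞)`). -/
noncomputable def runningMax (g : ℝ → ℝ) (s : ℝ) : ℝ :=
  sSup (g '' Icc 0 s)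

/-- `runningMax` changes nothing on nondecreasing functions. -/
theorem runningMax_of_monotoneOn {g : ℝ → ℝ} (hg : MonotoneOn g (Ici 0)) {s : ℝ} (hs : 0 ≤ s) :
    runningMax g s = g s := by
  refine IsGreatest.csSup_eq ⟨⟨s, ⟨hs, le_rfl⟩, rfl⟩, ?_⟩
  rintro _ ⟨t, ht, rfl⟩
  exact hg ht.1 hs ht.2

/-- `α_Y ∘ ᾱ_Y⁻¹`. -/
noncomputable def decayRate (αY αYup : ℝ → ℝ) : ℝ → ℝ :=
  fun s => αY (kinv αYup s)

/-- `β(s, k) = α̲_Y⁻¹ ( max_{t ∈ [0, ᾱ_Y(s)]} (𝕀 - α_Y ∘ ᾱ_Y⁻¹)^(k) (t) )`. When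
`𝕀 - α_Y ∘ ᾱ_Y⁻¹` is nondecreasing this is `α̲_Y⁻¹ ∘ (𝕀 - α_Y ∘ ᾱ_Y⁻¹)^(k) ∘ ᾱ_Y (s)`. -/
noncomputable def betaFun (αYlow αY αYup : ℝ → ℝ) (s : ℝ) (k : ℕ) : ℝ :=
  kinv αYlow (runningMax ((fun t => t - decayRate αY αYup t)^[k]) (αYup s))

section General

/-! Here `χ`, `αW`, `αWup`, `αV` stand for `χ_W`, `α_W`, `ᾱ_W`, `ᾱ_V`. -/

/-- `q_V = 2 χ_W(2 𝕀)`. -/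
noncomputable def qV (χ : ℝ → ℝ) : ℝ → ℝ :=
  fun s => 2 * χ (2 * s)

/-- `q_W = ½ [χ_W + (ᾱ_W + 𝕀) ∘ α_W⁻¹(2 χ_W)]⁻¹`, an inverse function. -/
noncomputable def qW (χ αW αWup : ℝ → ℝ) : ℝ → ℝ :=
  fun s => (1 / 2) *
    kinv (fun t => χ t + (αWup (kinv αW (2 * χ t)) + kinv αW (2 * χ t))) s

noncomputable def rhoV (χ : ℝ → ℝ) : ℝ → ℝ :=
  fun s => ∫ τ in (0 : ℝ)..s, qV χ τ

noncomputable def rhoW (χ αW αWup : ℝ → ℝ) : ℝ → ℝ :=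
  fun s => ∫ τ in (0 : ℝ)..s, qW χ αW αWup τ

/-- `α_Y = q_W(¼ α_W) ¼ α_W`. -/
noncomputable def alphaY (χ αW αWup : ℝ → ℝ) : ℝ → ℝ :=
  fun s => qW χ αW αWup ((1 / 4) * αW s) * ((1 / 4) * αW s)

/-- `ᾱ_Y = ρ_V ∘ ᾱ_V + ρ_W ∘ ᾱ_W`. -/
noncomputable def alphaYUp (χ αW αWup αV : ℝ → ℝ) : ℝ → ℝ :=
  fun s => rhoV χ (αV s) + rhoW χ αW αWup (αWup s)

/-- `α̲_Y = min {ρ_V ∘ χ_W⁻¹(½ α_W), ρ_W(½ α_W)}`. -/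
noncomputable def alphaYLow (χ αW αWup : ℝ → ℝ) : ℝ → ℝ :=
  fun s => min (rhoV χ (kinv χ ((1 / 2) * αW s))) (rhoW χ αW αWup ((1 / 2) * αW s))

/-- `β` in the general case. -/
noncomputable def betaGen (χ αW αWup αV : ℝ → ℝ) : ℝ → ℕ → ℝ :=
  betaFun (alphaYLow χ αW αWup) (alphaY χ αW αWup) (alphaYUp χ αW αWup αV)

/-- `α̂ = ᾱ_V - χ_W⁻¹(max {0, α_W - ᾱ_W})`. -/
noncomputable def alphaHatGen (χ αW αWup αV : ℝ → ℝ) : ℝ → ℝ :=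
  fun s => αV s - kinv χ (max 0 (αW s - αWup s))

end General

section Contractive

/-! The simpler functions that are available when `χ_W ≤ 𝕀`. -/

/-- `β` for `α_Y = α̲_Y = α_W` and `ᾱ_Y = ᾱ_V + ᾱ_W`. -/
noncomputable def betaSimple (αW αWup αV : ℝ → ℝ) : ℝ → ℕ → ℝ :=
  betaFun αW αW (fun s => αV s + αWup s)

/-- `α̂ = min {ᾱ_V, ᾱ_Y - α̲_Y}`. -/
noncomputable def alphaHatSimple (αW αWup αV : ℝ → ℝ) : ℝ → ℝ :=
  fun s => min (αV s) (αV s + αWup s - αW s)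

end Contractive

/-! ### Assumptions and form of the bound -/

/-- Outer semicontinuity on the whole space: `limsup_{z → x} S z ⊆ S x` for every `x`. -/
def IsOuterSemicontinuous {X Y : Type*} [TopologicalSpace X] [TopologicalSpace Y]
    (S : X → Set Y) : Prop :=
  ∀ (x : X) (u : Y) (xs : ℕ → X) (us : ℕ → Y), Tendsto xs atTop (𝓝 x) → Tendsto us atTop (𝓝 u) →
    (∀ k, us k ∈ S (xs k)) → u ∈ S x

/-- For every initial state there is an admissible input sequence of finite and minimal cost. -/
def IsWellPosed {n m : ℕ} (P : ControlProblem n m) : Prop :=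
  ∀ x, ∃ u, P.Admissible x u ∧ P.cost x u ≠ ∞ ∧ ∀ v, P.Admissible x v → P.cost x u ≤ P.cost x v

/-- Detectability of the plant and the stage cost with respect to the state measure `σ`. -/
structure IsDetectable {n m : ℕ} (P : ControlProblem n m) (σ W : EuclideanSpace ℝ (Fin n) → ℝ≥0)
    (αW χ αWup : ℝ → ℝ) : Prop where
  continuous_W : Continuous W
  αW_kInf : IsClassKInf αW
  χ_kInf : IsClassKInf χ
  αWup_continuousOn : ContinuousOn αWup (Ici 0)
  αWup_monotoneOn : MonotoneOn αWup (Ici 0)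
  αWup_zero : αWup 0 = 0
  W_le : ∀ x, (W x : ℝ) ≤ αWup (σ x)
  W_diff_le : ∀ x, ∀ u ∈ P.U x, (W (P.f x u) : ℝ) - W x ≤ -αW (σ x) + χ (P.ℓ x u)

/-- The regularity conditions under which PI⁺ started from `h0` is studied. Level-boundedness of
the stage cost in `u`, locally uniformly in `x`, is only asked for admissible inputs. -/
structure FeasibilityAssumption {n m : ℕ} (P : ControlProblem n m)
    (σ : EuclideanSpace ℝ (Fin n) → ℝ≥0)
    (h0 : EuclideanSpace ℝ (Fin n) → EuclideanSpace ℝ (Fin m)) : Prop where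
  continuous_f : Continuous fun p : EuclideanSpace ℝ (Fin n) × EuclideanSpace ℝ (Fin m) =>
    P.f p.1 p.2
  continuous_ℓ : Continuous fun p : EuclideanSpace ℝ (Fin n) × EuclideanSpace ℝ (Fin m) =>
    P.ℓ p.1 p.2
  levelBounded : ∀ (x : EuclideanSpace ℝ (Fin n)) (a : ℝ), ∃ S ∈ 𝓝 x,
    ∃ B : Set (EuclideanSpace ℝ (Fin m)), Bornology.IsBounded B ∧
      ∀ z ∈ S, {u | u ∈ P.U z ∧ (P.ℓ z u : ℝ) ≤ a} ⊆ B
  outerSemicontinuous_U : IsOuterSemicontinuous P.U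
  lowerSemicontinuous_cost : LowerSemicontinuous (P.policyCost h0)
  compact_sublevel : ∀ Δ : ℝ, 0 < Δ → IsCompact {x | (σ x : ℝ) ≤ Δ}

/-- The explicit near-optimality bound `V_r^i(x) - V⋆(x) ≤ α(β(σ(x), i))`, with `β` of class `KL`
and `α` continuous, nondecreasing, zero at zero, and positive on `(0, ∞)` unless
`V⋆ = ᾱ_V ∘ σ` on some sublevel set `{σ ≤ s}`, `s > 0`. -/
structure IsExplicitBound {n m : ℕ} (P : ControlProblem n m)
    (σ : EuclideanSpace ℝ (Fin n) → ℝ≥0)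
    (h0 : EuclideanSpace ℝ (Fin n) → EuclideanSpace ℝ (Fin m)) (αV : ℝ → ℝ)
    (α : ℝ → ℝ) (β : ℝ → ℕ → ℝ) : Prop where
  classKL : IsClassKL β
  continuousOn : ContinuousOn α (Ici 0)
  monotoneOn : MonotoneOn α (Ici 0)
  map_zero : α 0 = 0
  pos : (∀ s : ℝ, 0 < s → ∃ x, (σ x : ℝ) ≤ s ∧ P.optValue x ≠ ENNReal.ofReal (αV (σ x))) →
    ∀ s : ℝ, 0 < s → 0 < α s
  bound : ∀ i x, (P.plusValue h0 i x).toReal - (P.optValue x).toReal ≤ α (β (σ x) i)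

/-! The proof combines a comparison along optimal solutions with a decay estimate for σ. Comparison:
a greedy policy for the current value V costs at most ℓ(x,u) + V(f(x,u)) for every admissible u, so
a PI⁺ step is at least as good as a step of value iteration (`plusValue_succ_le`). With u = h⋆(x),
subtracting Bellman's equation cancels the stage cost: the error at x after i+1 steps is at most the
error at f(x, h⋆(x)) after i steps. Iterating gives `plusValue_sub_optValue_le`. Feasibility is a
compactness argument. The minimizers are locally bounded, and regularization closes the graph of the
greedy map. The best cost is then attained by one policy and is again lower semicontinuous
(`exists_policyCost_eq_bestCost`), so the step can be repeated. Decay: along optimal solutions V⋆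
drops by ℓ, while W changes by at most χ(ℓ) - αW(σ). A suitably rescaled sum of the two is a strict
Lyapunov function (`isLyapunov_general`, `isLyapunov_of_le_mul`), and a scalar recursion turns it
into `le_betaFun` or `le_geometric`. Since the initial error is at most αV(σ) - V⋆, a lower bound on
V⋆ in terms of σ supplies the outer function, and `IsExplicitBound.of_le` assembles the pieces. -/

/-! ### Calculus of class K_∞ functions. -/

namespace IsClassKInf

variable {α γ q : ℝ → ℝ}

theorem monotoneOn (h : IsClassKInf α) : MonotoneOn α (Ici 0) := h.strictMonoOn.monotoneOn

theorem nonneg (h : IsClassKInf α) {s : ℝ} (hs : 0 ≤ s) : 0 ≤ α s := by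
  simpa [h.map_zero] using h.monotoneOn (mem_Ici.2 le_rfl) (mem_Ici.2 hs) hs

theorem pos (h : IsClassKInf α) {s : ℝ} (hs : 0 < s) : 0 < α s := by
  simpa [h.map_zero] using h.strictMonoOn (mem_Ici.2 le_rfl) (mem_Ici.2 hs.le) hs

theorem mapsTo (h : IsClassKInf α) : MapsTo α (Ici 0) (Ici 0) := fun _ hs => h.nonneg hs

theorem mono (h : IsClassKInf α) {s t : ℝ} (hs : 0 ≤ s) (hst : s ≤ t) : α s ≤ α t :=
  h.monotoneOn hs (hs.trans hst) hst

theorem le_iff_le (h : IsClassKInf α) {s t : ℝ} (hs : 0 ≤ s) (ht : 0 ≤ t) :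
    α s ≤ α t ↔ s ≤ t :=
  h.strictMonoOn.le_iff_le hs ht

theorem exists_apply_eq (h : IsClassKInf α) {s : ℝ} (hs : 0 ≤ s) : ∃ t, 0 ≤ t ∧ α t = s := by
  obtain ⟨b, hb0, hb⟩ :=
    ((eventually_ge_atTop (0 : ℝ)).and (h.tendsto_atTop.eventually_ge_atTop s)).exists
  obtain ⟨t, ht, hts⟩ := intermediate_value_Icc hb0 (h.continuousOn.mono Icc_subset_Ici_self)
    (show s ∈ Icc (α 0) (α b) from ⟨by rwa [h.map_zero], hb⟩)
  exact ⟨t, ht.1, hts⟩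

theorem kinv_nonneg (h : IsClassKInf α) {s : ℝ} (hs : 0 ≤ s) : 0 ≤ kinv α s :=
  Function.invFunOn_mem (s := Ici (0 : ℝ)) (h.exists_apply_eq hs)

theorem apply_kinv (h : IsClassKInf α) {s : ℝ} (hs : 0 ≤ s) : α (kinv α s) = s :=
  Function.invFunOn_eq (s := Ici (0 : ℝ)) (h.exists_apply_eq hs)

theorem kinv_apply (h : IsClassKInf α) {s : ℝ} (hs : 0 ≤ s) : kinv α (α s) = s :=
  h.strictMonoOn.injOn (h.kinv_nonneg (h.nonneg hs)) hs (h.apply_kinv (h.nonneg hs))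

theorem kinv_le_iff (h : IsClassKInf α) {s t : ℝ} (hs : 0 ≤ s) (ht : 0 ≤ t) :
    kinv α s ≤ t ↔ s ≤ α t := by
  rw [← h.le_iff_le (h.kinv_nonneg hs) ht, h.apply_kinv hs]

theorem le_kinv_iff (h : IsClassKInf α) {s t : ℝ} (hs : 0 ≤ s) (ht : 0 ≤ t) :
    t ≤ kinv α s ↔ α t ≤ s := by
  rw [← h.le_iff_le ht (h.kinv_nonneg hs), h.apply_kinv hs]

/-- A strictly increasing bijection of `[0, ∞)` is of class `K_∞`. -/
theorem of_surjOn (hm : StrictMonoOn α (Ici 0)) (hmaps : MapsTo α (Ici 0) (Ici 0))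
    (hs : SurjOn α (Ici 0) (Ici 0)) : IsClassKInf α where
  continuousOn := by
    -- An order isomorphism is a homeomorphism for the order topologies, so continuity comes for
    -- free.
    let e : Ici (0 : ℝ) ≃o Ici (0 : ℝ) := StrictMono.orderIsoOfSurjective
      (fun x => ⟨α x, hmaps x.2⟩) (fun x y hxy => hm x.2 y.2 hxy)
      (fun y => by
        obtain ⟨x, hx, hxy⟩ := hs y.2
        exact ⟨⟨x, hx⟩, Subtype.ext hxy⟩)
    rw [continuousOn_iff_continuous_domRestrict]
    exact continuous_subtype_val.comp e.continuous
  strictMonoOn := hm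
  map_zero := by
    obtain ⟨t, ht, h0⟩ := hs (mem_Ici.2 (le_refl (0 : ℝ)))
    exact le_antisymm (h0 ▸ hm.monotoneOn (mem_Ici.2 le_rfl) ht ht) (hmaps (mem_Ici.2 le_rfl))
  tendsto_atTop := by
    refine Filter.tendsto_atTop.2 fun b => ?_
    obtain ⟨t, ht, hb⟩ := hs (mem_Ici.2 (le_max_right b 0))
    filter_upwards [eventually_ge_atTop t] with s hst
    exact (le_max_left b 0).trans (hb ▸ hm.monotoneOn ht (le_trans ht hst) hst)

theorem kinv (h : IsClassKInf α) : IsClassKInf (kinv α) :=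
  of_surjOn
    (fun s hs t ht hst => by
      rw [← h.strictMonoOn.lt_iff_lt (h.kinv_nonneg hs) (h.kinv_nonneg ht), h.apply_kinv hs,
        h.apply_kinv ht]
      exact hst)
    (fun _ hs => h.kinv_nonneg hs)
    (fun t ht => ⟨α t, h.nonneg ht, h.kinv_apply ht⟩)

theorem comp (h : IsClassKInf α) (h' : IsClassKInf γ) : IsClassKInf (fun s => α (γ s)) where
  continuousOn := h.continuousOn.comp h'.continuousOn h'.mapsTo
  strictMonoOn := h.strictMonoOn.comp h'.strictMonoOn h'.mapsTo
  map_zero := by rw [h'.map_zero, h.map_zero]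
  tendsto_atTop := h.tendsto_atTop.comp h'.tendsto_atTop

theorem add_monotoneOn (h : IsClassKInf α) (hc : ContinuousOn γ (Ici 0))
    (hm : MonotoneOn γ (Ici 0)) (h0 : γ 0 = 0) : IsClassKInf (fun s => α s + γ s) where
  continuousOn := h.continuousOn.add hc
  strictMonoOn := h.strictMonoOn.add_monotone hm
  map_zero := by rw [h.map_zero, h0, add_zero]
  tendsto_atTop := by
    refine tendsto_atTop_mono' _ ?_ h.tendsto_atTop
    filter_upwards [eventually_ge_atTop (0 : ℝ)] with s hs
    have := hm (mem_Ici.2 le_rfl) (mem_Ici.2 hs) hs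
    linarith

theorem const_mul (h : IsClassKInf α) {c : ℝ} (hc : 0 < c) : IsClassKInf (fun s => c * α s) where
  continuousOn := h.continuousOn.const_mul c
  strictMonoOn := fun s hs t ht hst => mul_lt_mul_of_pos_left (h.strictMonoOn hs ht hst) hc
  map_zero := by rw [h.map_zero, mul_zero]
  tendsto_atTop := h.tendsto_atTop.const_mul_atTop hc

theorem mul (h : IsClassKInf α) (h' : IsClassKInf γ) : IsClassKInf (fun s => α s * γ s) where
  continuousOn := h.continuousOn.mul h'.continuousOn
  strictMonoOn := fun s hs t ht hst => mul_lt_mul'' (h.strictMonoOn hs ht hst)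
    (h'.strictMonoOn hs ht hst) (h.nonneg hs) (h'.nonneg hs)
  map_zero := by rw [h.map_zero, zero_mul]
  tendsto_atTop := h.tendsto_atTop.atTop_mul_atTop₀ h'.tendsto_atTop

theorem inf (h : IsClassKInf α) (h' : IsClassKInf γ) :
    IsClassKInf (fun s => min (α s) (γ s)) where
  continuousOn := h.continuousOn.inf h'.continuousOn
  strictMonoOn := fun s hs t ht hst =>
    min_lt_min (h.strictMonoOn hs ht hst) (h'.strictMonoOn hs ht hst)
  map_zero := by rw [h.map_zero, h'.map_zero, min_self]
  tendsto_atTop := by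
    refine Filter.tendsto_atTop.2 fun b => ?_
    filter_upwards [h.tendsto_atTop.eventually_ge_atTop b,
      h'.tendsto_atTop.eventually_ge_atTop b] with s h1 h2
    exact le_min h1 h2

theorem id : IsClassKInf (fun s => s) where
  continuousOn := continuousOn_id
  strictMonoOn := strictMono_id.strictMonoOn _
  map_zero := rfl
  tendsto_atTop := tendsto_id

theorem intervalIntegrable (h : IsClassKInf q) {a b : ℝ} (ha : 0 ≤ a) (hb : 0 ≤ b) :
    IntervalIntegrable q MeasureTheory.volume a b :=
  (h.continuousOn.mono fun _ ht => (le_min ha hb).trans ht.1).intervalIntegrable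

theorem integral_sub_integral (h : IsClassKInf q) {a b : ℝ} (ha : 0 ≤ a) (hb : 0 ≤ b) :
    (∫ τ in (0 : ℝ)..b, q τ) - ∫ τ in (0 : ℝ)..a, q τ = ∫ τ in a..b, q τ :=
  intervalIntegral.integral_interval_sub_left (h.intervalIntegrable le_rfl hb)
    (h.intervalIntegrable le_rfl ha)

/-- Since q is nondecreasing, its value at the left endpoint bounds it below. This and the
right-endpoint bound play the role of convexity of the rescalings ρ_V and ρ_W. -/
theorem mul_sub_le_integral_sub (h : IsClassKInf q) {a b : ℝ} (ha : 0 ≤ a) (hab : a ≤ b) :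
    (b - a) * q a ≤ (∫ τ in (0 : ℝ)..b, q τ) - ∫ τ in (0 : ℝ)..a, q τ := by
  rw [h.integral_sub_integral ha (ha.trans hab)]
  have := intervalIntegral.integral_mono_on hab (intervalIntegrable_const (c := q a))
    (h.intervalIntegrable ha (ha.trans hab)) (fun t ht => h.mono ha ht.1)
  simpa using this

theorem integral_sub_le_mul_sub (h : IsClassKInf q) {a b : ℝ} (ha : 0 ≤ a) (hab : a ≤ b) :
    (∫ τ in (0 : ℝ)..b, q τ) - (∫ τ in (0 : ℝ)..a, q τ) ≤ (b - a) * q b := by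
  rw [h.integral_sub_integral ha (ha.trans hab)]
  have := intervalIntegral.integral_mono_on hab (h.intervalIntegrable ha (ha.trans hab))
    (intervalIntegrable_const (c := q b)) (fun t ht => h.mono (ha.trans ht.1) ht.2)
  simpa using this

theorem integral (h : IsClassKInf q) : IsClassKInf (fun s => ∫ τ in (0 : ℝ)..s, q τ) where
  continuousOn := by
    have hc : Continuous fun t => q (max t 0) :=
      h.continuousOn.comp_continuous (by fun_prop) fun t => le_max_right t 0
    refine (intervalIntegral.continuous_primitive
      (fun a b => hc.intervalIntegrable (μ := MeasureTheory.volume) a b) 0).continuousOn.congr fun s hs => ?_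
    refine intervalIntegral.integral_congr fun t ht => ?_
    rw [uIcc_of_le hs] at ht
    simp [ht.1]
  strictMonoOn := fun s hs t ht hst => by
    have hs' : (0 : ℝ) ≤ s := hs
    -- Splitting at the midpoint handles s = 0, where q s vanishes: the upper half contributes a
    -- strictly positive amount.
    have h1 := h.mul_sub_le_integral_sub hs' (show s ≤ (s + t) / 2 by linarith)
    have h2 := h.mul_sub_le_integral_sub (show 0 ≤ (s + t) / 2 by linarith)
      (show (s + t) / 2 ≤ t by linarith)
    have h3 : 0 ≤ ((s + t) / 2 - s) * q s := mul_nonneg (by linarith) (h.nonneg hs')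
    have h4 : 0 < (t - (s + t) / 2) * q ((s + t) / 2) :=
      mul_pos (by linarith) (h.pos (by linarith))
    dsimp only
    linarith
  map_zero := intervalIntegral.integral_same
  tendsto_atTop := by
    have : Tendsto (fun s : ℝ => (s - 1) * q 1) atTop atTop :=
      (tendsto_atTop_add_const_right _ (-1) tendsto_id).atTop_mul_const (h.pos one_pos)
    refine tendsto_atTop_mono' _ ?_ this
    filter_upwards [eventually_ge_atTop (1 : ℝ)] with s hs
    have h1 := h.mul_sub_le_integral_sub zero_le_one hs
    have h2 := h.mul_sub_le_integral_sub le_rfl zero_le_one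
    simp only [h.map_zero, mul_zero, intervalIntegral.integral_same] at h2
    linarith

end IsClassKInf

/-! ### Running maxima. -/

section RunningMax

variable {g : ℝ → ℝ}

theorem bddAbove_image_Icc (hg : ContinuousOn g (Ici 0)) (s : ℝ) : BddAbove (g '' Icc 0 s) :=
  (isCompact_Icc.image_of_continuousOn (hg.mono Icc_subset_Ici_self)).bddAbove

theorem le_runningMax (hg : ContinuousOn g (Ici 0)) {s t : ℝ} (ht : t ∈ Icc 0 s) :
    g t ≤ runningMax g s :=
  le_csSup (bddAbove_image_Icc hg s) (mem_image_of_mem g ht)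

theorem exists_eq_runningMax (hg : ContinuousOn g (Ici 0)) {s : ℝ} (hs : 0 ≤ s) :
    ∃ t ∈ Icc 0 s, g t = runningMax g s :=
  (isCompact_Icc.image_of_continuousOn (hg.mono Icc_subset_Ici_self)).sSup_mem
    ((nonempty_Icc.2 hs).image g)

theorem runningMax_le {s b : ℝ} (hs : 0 ≤ s) (h : ∀ t ∈ Icc 0 s, g t ≤ b) :
    runningMax g s ≤ b :=
  csSup_le ((nonempty_Icc.2 hs).image g) (by rintro _ ⟨t, ht, rfl⟩; exact h t ht)

theorem monotoneOn_runningMax (hg : ContinuousOn g (Ici 0)) :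
    MonotoneOn (runningMax g) (Ici 0) := fun _ hs _ _ hst =>
  runningMax_le hs fun _ hr => le_runningMax hg ⟨hr.1, hr.2.trans hst⟩

theorem runningMax_zero : runningMax g 0 = g 0 := by
  simp [runningMax]

theorem continuousOn_runningMax (hg : ContinuousOn g (Ici 0)) :
    ContinuousOn (runningMax g) (Ici 0) := by
  have hc : Continuous fun t => g (max t 0) :=
    hg.comp_continuous (by fun_prop) fun t => le_max_right t 0
  have hc' : Continuous fun p : ℝ × ℝ => g (max (p.1 * p.2) 0) :=
    hc.comp (continuous_fst.mul continuous_snd)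
  -- Rescaling [0, s] to [0, 1] makes this a supremum over a fixed compact set of a jointly
  -- continuous function.
  have key := (isCompact_Icc (a := (0 : ℝ)) (b := 1)).continuous_sSup
    (f := fun s t : ℝ => g (max (s * t) 0)) hc'
  refine key.continuousOn.congr fun s hs => ?_
  have hs' : (0 : ℝ) ≤ s := hs
  rw [runningMax]
  congr 1
  ext y
  constructor
  · rintro ⟨t, ht, rfl⟩
    rcases hs'.eq_or_lt with rfl | hpos
    · have : t = 0 := le_antisymm ht.2 ht.1
      exact ⟨0, by simp, by simp [this]⟩
    · refine ⟨t / s, ⟨div_nonneg ht.1 hs', (div_le_one hpos).2 ht.2⟩, ?_⟩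
      simp [mul_div_cancel₀ t hpos.ne', ht.1]
  · rintro ⟨t, ht, rfl⟩
    have h0 : 0 ≤ s * t := mul_nonneg hs' ht.1
    exact ⟨s * t, ⟨h0, mul_le_of_le_one_right hs' ht.2⟩, by simp [h0]⟩

end RunningMax

/-! ### Iterates of a scalar map below the identity. -/

section Iterate

variable {T : ℝ → ℝ}

theorem iterate_mem_Ici (hT0 : ∀ t, 0 ≤ t → 0 ≤ T t) {t : ℝ} (ht : 0 ≤ t) (k : ℕ) :
    0 ≤ T^[k] t := by
  induction k with
  | zero => exact ht
  | succ k ih => rw [Function.iterate_succ_apply']; exact hT0 _ ih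

theorem continuousOn_iterate (hc : ContinuousOn T (Ici 0)) (hT0 : ∀ t, 0 ≤ t → 0 ≤ T t) (k : ℕ) :
    ContinuousOn T^[k] (Ici 0) :=
  hc.iterate (fun t ht => hT0 t ht) k

theorem antitone_iterate (hT0 : ∀ t, 0 ≤ t → 0 ≤ T t) (hT : ∀ t, 0 ≤ t → T t ≤ t) {t : ℝ}
    (ht : 0 ≤ t) : Antitone fun k => T^[k] t :=
  antitone_nat_of_succ_le fun k => by
    rw [Function.iterate_succ_apply']
    exact hT _ (iterate_mem_Ici hT0 ht k)

/-- The iterates decrease, and by continuity their limit is a fixed point of T; no positive fixed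
point exists. -/
theorem tendsto_iterate_zero (hc : ContinuousOn T (Ici 0)) (hT0 : ∀ t, 0 ≤ t → 0 ≤ T t)
    (hT : ∀ t, 0 < t → T t < t) (hT' : ∀ t, 0 ≤ t → T t ≤ t) {t : ℝ} (ht : 0 ≤ t) :
    Tendsto (fun k => T^[k] t) atTop (𝓝 0) := by
  have hanti := antitone_iterate hT0 hT' ht
  have hbdd : BddBelow (range fun k => T^[k] t) :=
    ⟨0, by rintro _ ⟨k, rfl⟩; exact iterate_mem_Ici hT0 ht k⟩
  have hlim := tendsto_atTop_ciInf hanti hbdd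
  set L := ⨅ k, T^[k] t
  have hL : 0 ≤ L := le_ciInf fun k => iterate_mem_Ici hT0 ht k
  have h1 : Tendsto (fun k => T (T^[k] t)) atTop (𝓝 (T L)) :=
    (hc L hL).tendsto.comp (tendsto_nhdsWithin_iff.2
      ⟨hlim, Eventually.of_forall fun k => iterate_mem_Ici hT0 ht k⟩)
  have h2 : Tendsto (fun k => T (T^[k] t)) atTop (𝓝 L) := by
    simpa only [Function.iterate_succ_apply'] using (tendsto_add_atTop_iff_nat 1).2 hlim
  have hfix := tendsto_nhds_unique h1 h2
  rcases hL.eq_or_lt with h | h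
  · rwa [← h] at hlim
  · exact absurd hfix (hT L h).ne

/-- By Dini's theorem the monotone convergence of the iterates is uniform on [0, r]. -/
theorem tendsto_runningMax_iterate (hc : ContinuousOn T (Ici 0)) (hT0 : ∀ t, 0 ≤ t → 0 ≤ T t)
    (hT : ∀ t, 0 < t → T t < t) (hT' : ∀ t, 0 ≤ t → T t ≤ t) {r : ℝ} (hr : 0 ≤ r) :
    Tendsto (fun k => runningMax T^[k] r) atTop (𝓝 0) := by
  have hsub : Icc (0 : ℝ) r ⊆ Ici 0 := Icc_subset_Ici_self
  have hu : TendstoUniformlyOn (fun k => T^[k]) (fun _ => 0) atTop (Icc 0 r) :=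
    Antitone.tendstoUniformlyOn_of_forall_tendsto isCompact_Icc
      (fun k => (continuousOn_iterate hc hT0 k).mono hsub)
      (fun t ht => antitone_iterate hT0 hT' ht.1) continuousOn_const
      (fun t ht => tendsto_iterate_zero hc hT0 hT hT' ht.1)
  rw [Metric.tendstoUniformlyOn_iff] at hu
  rw [Metric.tendsto_nhds]
  intro ε hε
  filter_upwards [hu ε hε] with k hk
  obtain ⟨t, ht, h⟩ := exists_eq_runningMax (continuousOn_iterate hc hT0 k) hr
  rw [← h, dist_comm]
  exact hk t ht

/-- A sequence with `y (k + 1) ≤ T (y k)` stays below the running maximum of the iterates of `T`. -/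
theorem le_runningMax_iterate (hc : ContinuousOn T (Ici 0)) (hT0 : ∀ t, 0 ≤ t → 0 ≤ T t)
    (hTz : T 0 = 0) {y : ℕ → ℝ} (hy0 : ∀ k, 0 ≤ y k) (hy : ∀ k, y (k + 1) ≤ T (y k)) {r : ℝ}
    (hr : y 0 ≤ r) (k : ℕ) : y k ≤ runningMax T^[k] r := by
  have hr0 : 0 ≤ r := (hy0 0).trans hr
  induction k with
  | zero => exact hr.trans (le_runningMax (g := T^[0]) continuousOn_id ⟨hr0, le_rfl⟩)
  | succ k ih =>
    have hck := continuousOn_iterate hc hT0 k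
    obtain ⟨t, ht, htk⟩ := exists_eq_runningMax hck hr0
    -- T need not be monotone, so the bound on `y k` cannot be pushed through T. Instead `y k`
    -- itself is a value of the k-th iterate, which runs continuously from 0 at the origin up to the
    -- maximum at t.
    obtain ⟨s, hs, hsk⟩ := intermediate_value_Icc ht.1
      (hck.mono Icc_subset_Ici_self)
      (show y k ∈ Icc (T^[k] 0) (T^[k] t) from
        ⟨by rw [Function.iterate_fixed hTz]; exact hy0 k, htk ▸ ih⟩)
    calc y (k + 1) ≤ T (y k) := hy k
      _ = T^[k + 1] s := by rw [Function.iterate_succ_apply', hsk]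
      _ ≤ _ := le_runningMax (continuousOn_iterate hc hT0 _) ⟨hs.1, hs.2.trans ht.2⟩

end Iterate

/-! ### The KL function built from Lyapunov bounds. -/

section BetaFun

variable {αlow αd αup : ℝ → ℝ}

theorem isClassKInf_decayRate (hd : IsClassKInf αd) (hup : IsClassKInf αup) :
    IsClassKInf (decayRate αd αup) :=
  hd.comp hup.kinv

theorem sub_decayRate_continuousOn (hd : IsClassKInf αd) (hup : IsClassKInf αup) :
    ContinuousOn (fun t => t - decayRate αd αup t) (Ici 0) :=
  continuousOn_id.sub (isClassKInf_decayRate hd hup).continuousOn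

theorem sub_decayRate_nonneg (hup : IsClassKInf αup) (hle : ∀ s, 0 ≤ s → αd s ≤ αup s) (t : ℝ)
    (ht : 0 ≤ t) : 0 ≤ t - decayRate αd αup t := by
  have := hle _ (hup.kinv_nonneg ht)
  rw [hup.apply_kinv ht] at this
  exact sub_nonneg.2 this

theorem sub_decayRate_lt (hd : IsClassKInf αd) (hup : IsClassKInf αup) (t : ℝ) (ht : 0 < t) :
    t - decayRate αd αup t < t :=
  sub_lt_self _ ((isClassKInf_decayRate hd hup).pos ht)

theorem sub_decayRate_le (hd : IsClassKInf αd) (hup : IsClassKInf αup) (t : ℝ) (ht : 0 ≤ t) :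
    t - decayRate αd αup t ≤ t :=
  sub_le_self _ ((isClassKInf_decayRate hd hup).nonneg ht)

theorem runningMax_sub_decayRate_nonneg (hd : IsClassKInf αd) (hup : IsClassKInf αup)
    (hle : ∀ s, 0 ≤ s → αd s ≤ αup s) {r : ℝ} (hr : 0 ≤ r) (k : ℕ) :
    0 ≤ runningMax (fun t => t - decayRate αd αup t)^[k] r :=
  (iterate_mem_Ici (sub_decayRate_nonneg hup hle) le_rfl k).trans
    (le_runningMax (continuousOn_iterate (sub_decayRate_continuousOn hd hup)
      (sub_decayRate_nonneg hup hle) k) ⟨le_rfl, hr⟩)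

theorem isClassKL_betaFun (hlow : IsClassKInf αlow) (hd : IsClassKInf αd)
    (hup : IsClassKInf αup) (hle : ∀ s, 0 ≤ s → αd s ≤ αup s) :
    IsClassKL (betaFun αlow αd αup) := by
  have hc := sub_decayRate_continuousOn hd hup
  have h0 := sub_decayRate_nonneg (αd := αd) hup hle
  have hlt := sub_decayRate_lt hd hup
  have hle' := sub_decayRate_le hd hup
  have hM := fun {r : ℝ} (hr : 0 ≤ r) k => runningMax_sub_decayRate_nonneg hd hup hle hr k
  have hanti : ∀ {r : ℝ}, 0 ≤ r →
      Antitone fun k => runningMax (fun t => t - decayRate αd αup t)^[k] r := by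
    intro r hr j k hjk
    exact runningMax_le hr fun t ht => (antitone_iterate h0 hle' ht.1 hjk).trans
      (le_runningMax (continuousOn_iterate hc h0 j) ht)
  have hlim : Tendsto (kinv αlow) (𝓝[≥] 0) (𝓝 0) := by
    have := (hlow.kinv.continuousOn 0 (mem_Ici.2 le_rfl)).tendsto
    rwa [hlow.kinv.map_zero] at this
  refine ⟨fun s hs k => hlow.kinv_nonneg (hM (hup.nonneg hs) k),
    fun k s hs t ht hst => hlow.kinv.mono (hM (hup.nonneg hs) k)
      (monotoneOn_runningMax (continuousOn_iterate hc h0 k) (hup.nonneg hs) (hup.nonneg ht)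
        (hup.mono hs hst)),
    fun s hs j k hjk => hlow.kinv.mono (hM (hup.nonneg hs) k) (hanti (hup.nonneg hs) hjk),
    fun k => ?_, fun s hs => ?_⟩
  · refine hlim.comp (tendsto_nhdsWithin_iff.2 ⟨?_, ?_⟩)
    · have hu : Tendsto αup (𝓝[>] 0) (𝓝 0) := by
        have := (hup.continuousOn 0 (mem_Ici.2 le_rfl)).tendsto.mono_left
          (nhdsWithin_mono 0 Ioi_subset_Ici_self)
        rwa [hup.map_zero] at this
      refine tendsto_of_tendsto_of_tendsto_of_le_of_le' tendsto_const_nhds hu ?_ ?_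
      · filter_upwards [self_mem_nhdsWithin] with s hs
        exact hM (hup.nonneg (le_of_lt hs)) k
      · filter_upwards [self_mem_nhdsWithin] with s hs
        -- The iterates lie below the identity, so the maximum is squeezed between 0 and `αup s`.
        exact runningMax_le (hup.nonneg (le_of_lt hs)) fun t ht =>
          (antitone_iterate h0 hle' ht.1 (Nat.zero_le k)).trans ht.2
    · filter_upwards [self_mem_nhdsWithin] with s hs
      exact hM (hup.nonneg (le_of_lt hs)) k
  · exact hlim.comp (tendsto_nhdsWithin_iff.2
      ⟨tendsto_runningMax_iterate hc h0 hlt hle' (hup.nonneg hs),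
        Eventually.of_forall fun k => hM (hup.nonneg hs) k⟩)

end BetaFun

/-! ### Lyapunov functions and decay of the state measure. -/

/-- `Y` is a Lyapunov function for the map `F` with respect to the measure `σ`. -/
structure IsLyapunov {X : Type*} (F : X → X) (σ : X → ℝ≥0) (Y : X → ℝ) (αlow αd αup : ℝ → ℝ) :
    Prop where
  low : IsClassKInf αlow
  decay : IsClassKInf αd
  up : IsClassKInf αup
  low_le : ∀ x, αlow (σ x) ≤ Y x
  le_up : ∀ x, Y x ≤ αup (σ x)
  decrease : ∀ x, Y (F x) ≤ Y x - αd (σ x)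

namespace IsLyapunov

variable {X : Type*} {F : X → X} {σ : X → ℝ≥0} {Y : X → ℝ} {αlow αd αup : ℝ → ℝ}

theorem nonneg (h : IsLyapunov F σ Y αlow αd αup) (x : X) : 0 ≤ Y x :=
  (h.low.nonneg (σ x).2).trans (h.low_le x)

/-- Otherwise Y would lose at least `αd s` at every step and eventually become negative. -/
theorem exists_lt (h : IsLyapunov F σ Y αlow αd αup) [Nonempty X] {s : ℝ} (hs : 0 < s) :
    ∃ x, (σ x : ℝ) < s := by
  by_contra! hcon
  obtain ⟨x⟩ := ‹Nonempty X›
  have hk : ∀ k : ℕ, Y (F^[k] x) ≤ Y x - k * αd s := by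
    intro k
    induction k with
    | zero => simp
    | succ k ih =>
      rw [Function.iterate_succ_apply']
      have h1 := h.decrease (F^[k] x)
      have h2 := h.decay.mono hs.le (hcon (F^[k] x))
      push_cast
      linarith
  obtain ⟨k, hk'⟩ := exists_nat_gt (Y x / αd s)
  rw [div_lt_iff₀ (h.decay.pos hs)] at hk'
  linarith [hk k, h.nonneg (F^[k] x)]

/-- Small values of σ occur by decay, large ones because a noncompact space is no compact sublevel
set; connectedness fills the gap. -/
theorem exists_eq (h : IsLyapunov F σ Y αlow αd αup) [TopologicalSpace X]
    [PreconnectedSpace X] [NoncompactSpace X] [Nonempty X] (hσ : Continuous σ)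
    (hcomp : ∀ Δ : ℝ, 0 < Δ → IsCompact {x | (σ x : ℝ) ≤ Δ}) {s : ℝ} (hs : 0 < s) :
    ∃ x, (σ x : ℝ) = s := by
  obtain ⟨x, hx⟩ := h.exists_lt hs
  obtain ⟨y, hy⟩ : ∃ y, s ≤ (σ y : ℝ) := by
    by_contra! hcon
    refine noncompact_univ X ?_
    convert hcomp s hs
    exact (eq_univ_of_forall fun y => (hcon y).le).symm
  exact mem_range_of_exists_le_of_exists_ge (NNReal.continuous_coe.comp hσ) ⟨x, hx.le⟩ ⟨y, hy⟩

/-- This is what keeps the comparison map 𝕀 - αd ∘ αup⁻¹ nonnegative. The Lyapunov inequalities give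
it only at values of σ, so it matters that σ takes every positive value. -/
theorem decay_le_up (h : IsLyapunov F σ Y αlow αd αup) [TopologicalSpace X]
    [PreconnectedSpace X] [NoncompactSpace X] [Nonempty X] (hσ : Continuous σ)
    (hcomp : ∀ Δ : ℝ, 0 < Δ → IsCompact {x | (σ x : ℝ) ≤ Δ}) (s : ℝ) (hs : 0 ≤ s) :
    αd s ≤ αup s := by
  rcases hs.eq_or_lt with rfl | hs
  · rw [h.decay.map_zero, h.up.map_zero]
  · obtain ⟨x, rfl⟩ := h.exists_eq hσ hcomp hs
    linarith [h.decrease x, h.nonneg (F x), h.le_up x]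

theorem le_betaFun (h : IsLyapunov F σ Y αlow αd αup) (hle : ∀ s, 0 ≤ s → αd s ≤ αup s) (x : X)
    (k : ℕ) : (σ (F^[k] x) : ℝ) ≤ betaFun αlow αd αup (σ x) k := by
  have hYk : Y (F^[k] x) ≤
      runningMax (fun t => t - decayRate αd αup t)^[k] (αup (σ x)) := by
    refine le_runningMax_iterate (y := fun k => Y (F^[k] x))
      (sub_decayRate_continuousOn h.decay h.up) (sub_decayRate_nonneg h.up hle)
      (by rw [(isClassKInf_decayRate h.decay h.up).map_zero, sub_zero])
      (fun k => h.nonneg _) (fun k => ?_) (h.le_up x) k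
    rw [Function.iterate_succ_apply']
    refine (h.decrease _).trans (sub_le_sub_left ?_ _)
    exact h.decay.mono (h.up.kinv_nonneg (h.nonneg _))
      ((h.up.kinv_le_iff (h.nonneg _) (σ _).2).2 (h.le_up _))
  exact (h.low.le_kinv_iff (runningMax_sub_decayRate_nonneg h.decay h.up hle
    (h.up.nonneg (σ x).2) k) (σ _).2).2 ((h.low_le _).trans hYk)

end IsLyapunov

/-! ### Dynamic programming. -/

namespace ControlProblem

variable {n m : ℕ} (P : ControlProblem n m)

section DynamicProgramming

variable (h : EuclideanSpace ℝ (Fin n) → EuclideanSpace ℝ (Fin m))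

theorem closedLoop_eq_iterate (x : EuclideanSpace ℝ (Fin n)) (k : ℕ) :
    P.closedLoop h x k = (fun z => P.f z (h z))^[k] x := by
  induction k with
  | zero => rfl
  | succ k ih => rw [Function.iterate_succ_apply', ← ih]; rfl

theorem closedLoop_succ' (x : EuclideanSpace ℝ (Fin n)) (k : ℕ) :
    P.closedLoop h x (k + 1) = P.closedLoop h (P.f x (h x)) k := by
  rw [closedLoop_eq_iterate, closedLoop_eq_iterate, Function.iterate_succ_apply]

theorem policyCost_eq (x : EuclideanSpace ℝ (Fin n)) :
    P.policyCost h x = P.ℓ x (h x) + P.policyCost h (P.f x (h x)) := by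
  rw [policyCost, tsum_eq_zero_add' ENNReal.summable]
  simp only [closedLoop_succ']
  rfl

/-- The hypothesis telescopes along the closed loop, and the leftover value of V is nonnegative. -/
theorem policyCost_le {V : EuclideanSpace ℝ (Fin n) → ℝ≥0∞}
    (hV : ∀ x, (P.ℓ x (h x) : ℝ≥0∞) + V (P.f x (h x)) ≤ V x) (x : EuclideanSpace ℝ (Fin n)) :
    P.policyCost h x ≤ V x := by
  have key : ∀ N, ∑ k ∈ Finset.range N,
      (P.ℓ (P.closedLoop h x k) (h (P.closedLoop h x k)) : ℝ≥0∞) + V (P.closedLoop h x N)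
        ≤ V x := by
    intro N
    induction N with
    | zero => simp [closedLoop]
    | succ N ih =>
      rw [Finset.sum_range_succ, add_assoc]
      exact (add_le_add_right (hV (P.closedLoop h x N)) _).trans ih
  exact ENNReal.tsum_le_of_sum_range_le fun N => le_self_add.trans (key N)

theorem traj_succ' (x : EuclideanSpace ℝ (Fin n)) (u : ℕ → EuclideanSpace ℝ (Fin m)) (k : ℕ) :
    P.traj x u (k + 1) = P.traj (P.f x (u 0)) (fun j => u (j + 1)) k := by
  induction k with
  | zero => rfl
  | succ k ih => rw [traj, ih]; rfl

theorem cost_eq (x : EuclideanSpace ℝ (Fin n)) (u : ℕ → EuclideanSpace ℝ (Fin m)) :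
    P.cost x u = P.ℓ x (u 0) + P.cost (P.f x (u 0)) (fun j => u (j + 1)) := by
  rw [cost, tsum_eq_zero_add' ENNReal.summable]
  simp only [traj_succ']
  rfl

theorem admissible_iff (x : EuclideanSpace ℝ (Fin n)) (u : ℕ → EuclideanSpace ℝ (Fin m)) :
    P.Admissible x u ↔ u 0 ∈ P.U x ∧ P.Admissible (P.f x (u 0)) (fun j => u (j + 1)) := by
  constructor
  · intro hu
    exact ⟨hu 0, fun k => by rw [← traj_succ']; exact hu (k + 1)⟩
  · rintro ⟨h1, h2⟩ (_ | k)
    · exact h1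
    · rw [traj_succ']; exact h2 k

variable {P h}

theorem optValue_le_cost {x : EuclideanSpace ℝ (Fin n)} {u : ℕ → EuclideanSpace ℝ (Fin m)}
    (hu : P.Admissible x u) : P.optValue x ≤ P.cost x u :=
  iInf₂_le u hu

theorem optValue_le_policyCost (hh : IsSelection P.U h) (x : EuclideanSpace ℝ (Fin n)) :
    P.optValue x ≤ P.policyCost h x := by
  have htraj : ∀ k, P.traj x (fun j => h (P.closedLoop h x j)) k = P.closedLoop h x k := by
    intro k
    induction k with
    | zero => rfl
    | succ k ih => rw [traj, ih]; rfl
  have : P.cost x (fun j => h (P.closedLoop h x j)) = P.policyCost h x := by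
    simp only [cost, policyCost, htraj]
  rw [← this]
  exact optValue_le_cost fun k => by rw [htraj]; exact hh _

theorem _root_.IsWellPosed.exists_cost_eq (hwell : IsWellPosed P)
    (x : EuclideanSpace ℝ (Fin n)) : ∃ u, P.Admissible x u ∧ P.cost x u = P.optValue x := by
  obtain ⟨u, hu, -, hmin⟩ := hwell x
  exact ⟨u, hu, le_antisymm (le_iInf₂ hmin) (optValue_le_cost hu)⟩

theorem _root_.IsWellPosed.optValue_ne_top (hwell : IsWellPosed P)
    (x : EuclideanSpace ℝ (Fin n)) : P.optValue x ≠ ∞ := by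
  obtain ⟨u, hu, hfin, -⟩ := hwell x
  exact ne_top_of_le_ne_top hfin (optValue_le_cost hu)

theorem _root_.IsWellPosed.optValue_le_add (hwell : IsWellPosed P)
    {x : EuclideanSpace ℝ (Fin n)} {u : EuclideanSpace ℝ (Fin m)} (hu : u ∈ P.U x) :
    P.optValue x ≤ P.ℓ x u + P.optValue (P.f x u) := by
  obtain ⟨v, hv, hcost⟩ := hwell.exists_cost_eq (P.f x u)
  -- The input u followed by an optimal sequence from the successor state.
  let w : ℕ → EuclideanSpace ℝ (Fin m) := fun k => Nat.casesOn k u v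
  have hw : P.Admissible x w := (P.admissible_iff x w).2 ⟨hu, hv⟩
  calc P.optValue x ≤ P.cost x w := optValue_le_cost hw
    _ = P.ℓ x u + P.cost (P.f x u) v := P.cost_eq x w
    _ = _ := by rw [hcost]

theorem _root_.IsWellPosed.exists_add_le_optValue (hwell : IsWellPosed P)
    (x : EuclideanSpace ℝ (Fin n)) :
    ∃ u ∈ P.U x, P.ℓ x u + P.optValue (P.f x u) ≤ P.optValue x := by
  obtain ⟨u, hu, hcost⟩ := hwell.exists_cost_eq x
  obtain ⟨h1, h2⟩ := (P.admissible_iff x u).1 hu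
  refine ⟨u 0, h1, ?_⟩
  rw [← hcost, cost_eq]
  exact add_le_add_right (optValue_le_cost h2) _

/-- Bellman's equation along an optimal feedback law. -/
theorem _root_.IsWellPosed.optValue_eq (hwell : IsWellPosed P)
    (hh : IsSelection P.optInputs h) (x : EuclideanSpace ℝ (Fin n)) :
    P.optValue x = P.ℓ x (h x) + P.optValue (P.f x (h x)) := by
  obtain ⟨u, hu, hle⟩ := hwell.exists_add_le_optValue x
  exact le_antisymm (hwell.optValue_le_add (hh x).1) (((hh x).2 u hu).trans hle)

theorem _root_.IsWellPosed.exists_isSelection_optInputs (hwell : IsWellPosed P) :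
    ∃ h, IsSelection P.optInputs h := by
  choose h hU hle using hwell.exists_add_le_optValue
  exact ⟨h, fun x => ⟨hU x, fun v hv => (hle x).trans (hwell.optValue_le_add hv)⟩⟩

end DynamicProgramming

end ControlProblem

/-! ### Set-valued maps with closed graph and marginal functions. -/

section Semicontinuity

variable {X Y : Type*} [MetricSpace X] [MetricSpace Y]

/-- The values of `S` near any given point stay in a bounded set. -/
def IsLocallyBoundedMap (S : X → Set Y) : Prop :=
  ∀ x, ∃ N ∈ 𝓝 x, ∃ B : Set Y, Bornology.IsBounded B ∧ ∀ z ∈ N, S z ⊆ B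

theorem IsOuterSemicontinuous.isClosed_graph {S : X → Set Y} (hS : IsOuterSemicontinuous S) :
    IsClosed {p : X × Y | p.2 ∈ S p.1} := by
  refine IsSeqClosed.isClosed fun p q hp hq => ?_
  exact hS q.1 q.2 (fun k => (p k).1) (fun k => (p k).2) ((continuous_fst.tendsto q).comp hq)
    ((continuous_snd.tendsto q).comp hq) hp

theorem isClosed_of_isClosed_graph {S : X → Set Y} (hS : IsClosed {p : X × Y | p.2 ∈ S p.1})
    (x : X) : IsClosed (S x) :=
  hS.preimage (Continuous.prodMk_right x)

theorem IsLocallyBoundedMap.isCompact [ProperSpace Y] {S : X → Set Y} (hb : IsLocallyBoundedMap S)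
    (hS : IsClosed {p : X × Y | p.2 ∈ S p.1}) (x : X) : IsCompact (S x) := by
  obtain ⟨N, hN, B, hB, hsub⟩ := hb x
  exact Metric.isCompact_of_isClosed_isBounded (isClosed_of_isClosed_graph hS x)
    (hB.subset (hsub x (mem_of_mem_nhds hN)))

/-- The domain of a locally bounded set-valued map with closed graph is closed. -/
theorem IsLocallyBoundedMap.isClosed_domain [ProperSpace Y] {S : X → Set Y} (hb : IsLocallyBoundedMap S)
    (hS : IsClosed {p : X × Y | p.2 ∈ S p.1}) : IsClosed {x | (S x).Nonempty} := by
  refine IsSeqClosed.isClosed fun xs x hxs hx => ?_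
  choose us hus using hxs
  obtain ⟨N, hN, B, hB, hsub⟩ := hb x
  have hev : ∀ᶠ k in atTop, us k ∈ B := by
    filter_upwards [hx hN] with k hk using hsub _ hk (hus k)
  obtain ⟨u, -, φ, hφ, hlim⟩ := tendsto_subseq_of_frequently_bounded hB hev.frequently
  have hmem : (x, u) ∈ {p : X × Y | p.2 ∈ S p.1} :=
    hS.mem_of_tendsto ((hx.comp hφ.tendsto_atTop).prodMk_nhds hlim)
      (Eventually.of_forall fun k => hus (φ k))
  exact ⟨u, hmem⟩

theorem IsLocallyBoundedMap.mono {S T : X → Set Y} (hb : IsLocallyBoundedMap S)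
    (h : ∀ x, T x ⊆ S x) : IsLocallyBoundedMap T := fun x => by
  obtain ⟨N, hN, B, hB, hsub⟩ := hb x
  exact ⟨N, hN, B, hB, fun z hz => (h z).trans (hsub z hz)⟩

theorem isClosed_setOf_le_of_lowerSemicontinuous {g : X × Y → ℝ≥0∞} (hg : LowerSemicontinuous g)
    (c : ℝ≥0∞) : IsClosed {p | g p ≤ c} :=
  lowerSemicontinuous_iff_isClosed_preimage.1 hg c

theorem exists_iInf_eq {S : Set Y} (hne : S.Nonempty) (hS : IsCompact S) {g : Y → ℝ≥0∞}
    (hg : LowerSemicontinuous g) : ∃ u ∈ S, g u = ⨅ v ∈ S, g v := by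
  obtain ⟨u, hu, hmin⟩ := (hg.lowerSemicontinuousOn S).exists_isMinOn hne hS
  exact ⟨u, hu, le_antisymm (le_iInf₂ fun v hv => hmin hv) (iInf₂_le u hu)⟩

/-- Marginal functions of lower semicontinuous functions are lower semicontinuous. -/
theorem IsLocallyBoundedMap.lowerSemicontinuous_iInf [ProperSpace Y] {S : X → Set Y}
    (hb : IsLocallyBoundedMap S) (hne : ∀ x, (S x).Nonempty)
    (hS : IsClosed {p : X × Y | p.2 ∈ S p.1}) {g : X → Y → ℝ≥0∞}
    (hg : LowerSemicontinuous fun p : X × Y => g p.1 p.2) :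
    LowerSemicontinuous fun x => ⨅ u ∈ S x, g x u := by
  rw [lowerSemicontinuous_iff_isClosed_preimage]
  intro c
  -- Because the infimum is attained, the sublevel set at c is exactly the domain of this truncated
  -- map.
  have h1 := (hb.mono (T := fun x => {u | u ∈ S x ∧ g x u ≤ c}) fun x u hu => hu.1).isClosed_domain
    (hS.inter (isClosed_setOf_le_of_lowerSemicontinuous hg c))
  convert h1 using 1
  ext x
  obtain ⟨u, hu, hmin⟩ := exists_iInf_eq (hne x) (hb.isCompact hS x)
    (hg.comp (Continuous.prodMk_right x))
  constructor
  · intro hx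
    exact ⟨u, hu, hmin.le.trans hx⟩
  · rintro ⟨v, hv, hvc⟩
    exact (iInf₂_le (f := fun u (_ : u ∈ S x) => g x u) v hv).trans hvc

end Semicontinuity

/-! ### Outer semicontinuous regularization. -/

section Regularize

variable {n m : ℕ} {H : EuclideanSpace ℝ (Fin n) → Set (EuclideanSpace ℝ (Fin m))}

theorem subset_regularize (x : EuclideanSpace ℝ (Fin n)) :
    H x ⊆ ControlProblem.regularize H x := fun _ hu =>
  mem_iInter₂.2 fun _ hδ => subset_closure
    (mem_biUnion (Metric.mem_closedBall_self (le_of_lt hδ)) hu)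

/-- Being in every closure over shrinking balls means being approximable in state and input
simultaneously. Closedness of the graph and inclusion in any outer semicontinuous map containing `H`
both follow. -/
theorem setOf_mem_regularize_eq_closure :
    {p : EuclideanSpace ℝ (Fin n) × EuclideanSpace ℝ (Fin m) |
      p.2 ∈ ControlProblem.regularize H p.1} = closure {p | p.2 ∈ H p.1} := by
  ext ⟨x, u⟩
  simp only [mem_ofPred_eq, ControlProblem.regularize, mem_iInter]
  constructor
  · intro h
    refine Metric.mem_closure_iff.2 fun ε hε => ?_
    obtain ⟨v, hv, huv⟩ := Metric.mem_closure_iff.1 (h (ε / 2) (half_pos hε)) ε hε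
    obtain ⟨y, hy, hvy⟩ := mem_iUnion₂.1 hv
    refine ⟨(y, v), hvy, ?_⟩
    rw [Prod.dist_eq]
    refine max_lt ?_ huv
    rw [dist_comm]
    exact (Metric.mem_closedBall.1 hy).trans_lt (half_lt_self hε)
  · intro h δ hδ
    refine Metric.mem_closure_iff.2 fun ε hε => ?_
    obtain ⟨⟨y, v⟩, hv, hd⟩ := Metric.mem_closure_iff.1 h (min δ ε) (lt_min hδ hε)
    rw [Prod.dist_eq, max_lt_iff] at hd
    refine ⟨v, mem_biUnion (x := y) ?_ hv, hd.2.trans_le (min_le_right _ _)⟩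
    rw [Metric.mem_closedBall, dist_comm]
    exact (hd.1.trans_le (min_le_left _ _)).le

theorem isClosed_graph_regularize :
    IsClosed {p : EuclideanSpace ℝ (Fin n) × EuclideanSpace ℝ (Fin m) |
      p.2 ∈ ControlProblem.regularize H p.1} :=
  setOf_mem_regularize_eq_closure (H := H) ▸ isClosed_closure

theorem regularize_subset {S : EuclideanSpace ℝ (Fin n) → Set (EuclideanSpace ℝ (Fin m))}
    (hS : IsOuterSemicontinuous S) (h : ∀ x, H x ⊆ S x) (x : EuclideanSpace ℝ (Fin n)) :
    ControlProblem.regularize H x ⊆ S x := fun u hu => by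
  have hmem : (x, u) ∈ closure {p : EuclideanSpace ℝ (Fin n) × EuclideanSpace ℝ (Fin m) |
      p.2 ∈ H p.1} := setOf_mem_regularize_eq_closure (H := H) ▸ hu
  exact closure_minimal (fun p hp => h p.1 hp) hS.isClosed_graph hmem

theorem IsLocallyBoundedMap.regularize (hb : IsLocallyBoundedMap H) :
    IsLocallyBoundedMap (ControlProblem.regularize H) := fun x => by
  obtain ⟨N, hN, B, hB, hsub⟩ := hb x
  refine ⟨interior N, interior_mem_nhds.2 hN, closure B, hB.closure, fun z hz u hu => ?_⟩
  obtain ⟨δ, hδ, hball⟩ := Metric.nhds_basis_closedBall.mem_iff.1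
    (isOpen_interior.mem_nhds hz)
  exact closure_mono (iUnion₂_subset fun y hy => hsub y (interior_subset (hball hy)))
    (mem_iInter₂.1 hu δ hδ)

end Regularize

/-! ### Attainment of the best cost and the PI⁺ step. -/

namespace ControlProblem

variable {n m : ℕ} (P : ControlProblem n m)

/-- Value iteration restricted to the inputs in `H`, started from zero. -/
noncomputable def iterValue (H : EuclideanSpace ℝ (Fin n) → Set (EuclideanSpace ℝ (Fin m))) :
    ℕ → EuclideanSpace ℝ (Fin n) → ℝ≥0∞
  | 0 => fun _ => 0
  | k + 1 => fun x => ⨅ u ∈ H x, (P.ℓ x u : ℝ≥0∞) + iterValue H k (P.f x u)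

variable {P} {H : EuclideanSpace ℝ (Fin n) → Set (EuclideanSpace ℝ (Fin m))}

theorem iterValue_mono : Monotone (P.iterValue H) := by
  refine monotone_nat_of_le_succ fun k => ?_
  induction k with
  | zero => exact fun x => zero_le
  | succ k ih => exact fun x => iInf₂_mono fun u _ => add_le_add_right (ih _) _

theorem iterValue_le_policyCost {h : EuclideanSpace ℝ (Fin n) → EuclideanSpace ℝ (Fin m)}
    (hh : IsSelection H h) (k : ℕ) (x : EuclideanSpace ℝ (Fin n)) :
    P.iterValue H k x ≤ P.policyCost h x := by
  induction k generalizing x with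
  | zero => exact zero_le
  | succ k ih =>
    rw [policyCost_eq]
    exact (iInf₂_le (h x) (hh x)).trans (add_le_add_right (ih _) _)

theorem bestCost_le {h : EuclideanSpace ℝ (Fin n) → EuclideanSpace ℝ (Fin m)}
    (hh : IsSelection H h) (x : EuclideanSpace ℝ (Fin n)) :
    P.bestCost H x ≤ P.policyCost h x :=
  iInf₂_le h hh

theorem lowerSemicontinuous_stage
    (hf : Continuous fun p : EuclideanSpace ℝ (Fin n) × EuclideanSpace ℝ (Fin m) => P.f p.1 p.2)
    (hℓ : Continuous fun p : EuclideanSpace ℝ (Fin n) × EuclideanSpace ℝ (Fin m) => P.ℓ p.1 p.2)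
    {V : EuclideanSpace ℝ (Fin n) → ℝ≥0∞} (hV : LowerSemicontinuous V) :
    LowerSemicontinuous fun p : EuclideanSpace ℝ (Fin n) × EuclideanSpace ℝ (Fin m) =>
      (P.ℓ p.1 p.2 : ℝ≥0∞) + V (P.f p.1 p.2) :=
  (ENNReal.continuous_coe.comp hℓ).lowerSemicontinuous.add (hV.comp hf)

theorem lowerSemicontinuous_iterValue
    (hf : Continuous fun p : EuclideanSpace ℝ (Fin n) × EuclideanSpace ℝ (Fin m) => P.f p.1 p.2)
    (hℓ : Continuous fun p : EuclideanSpace ℝ (Fin n) × EuclideanSpace ℝ (Fin m) => P.ℓ p.1 p.2)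
    (hb : IsLocallyBoundedMap H) (hne : ∀ x, (H x).Nonempty)
    (hcl : IsClosed {p : EuclideanSpace ℝ (Fin n) × EuclideanSpace ℝ (Fin m) | p.2 ∈ H p.1})
    (k : ℕ) : LowerSemicontinuous (P.iterValue H k) := by
  induction k with
  | zero => exact lowerSemicontinuous_const
  | succ k ih =>
    exact hb.lowerSemicontinuous_iInf hne hcl
      (g := fun x u => (P.ℓ x u : ℝ≥0∞) + P.iterValue H k (P.f x u))
      (lowerSemicontinuous_stage hf hℓ ih)

/-- For a nonempty-valued, locally bounded `H` with closed graph, a single selection attains the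
best cost at all states, and the best cost is lower semicontinuous. -/
theorem exists_policyCost_eq_bestCost
    (hf : Continuous fun p : EuclideanSpace ℝ (Fin n) × EuclideanSpace ℝ (Fin m) => P.f p.1 p.2)
    (hℓ : Continuous fun p : EuclideanSpace ℝ (Fin n) × EuclideanSpace ℝ (Fin m) => P.ℓ p.1 p.2)
    (hb : IsLocallyBoundedMap H) (hne : ∀ x, (H x).Nonempty)
    (hcl : IsClosed {p : EuclideanSpace ℝ (Fin n) × EuclideanSpace ℝ (Fin m) | p.2 ∈ H p.1}) :
    (∃ h, IsSelection H h ∧ P.policyCost h = P.bestCost H) ∧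
      LowerSemicontinuous (P.bestCost H) := by
  have hlsc := fun k => lowerSemicontinuous_iterValue hf hℓ hb hne hcl k
  set v : EuclideanSpace ℝ (Fin n) → ℝ≥0∞ := fun x => ⨆ k, P.iterValue H k x with hv
  have hgreedy : ∀ x, ∃ u ∈ H x, (P.ℓ x u : ℝ≥0∞) + v (P.f x u) ≤ v x := by
    intro x
    -- These sets are compact, nonempty and decreasing in k. A common point is an input that works
    -- for all iterates, hence for their supremum; this interchanges the minimum over inputs with
    -- the limit in k.
    let K : ℕ → Set (EuclideanSpace ℝ (Fin m)) := fun k =>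
      {u | u ∈ H x ∧ (P.ℓ x u : ℝ≥0∞) + P.iterValue H k (P.f x u) ≤ v x}
    have hg := fun k => (lowerSemicontinuous_stage hf hℓ (hlsc k)).comp (Continuous.prodMk_right x)
    have hKcl : ∀ k, IsClosed (K k) := fun k =>
      (isClosed_of_isClosed_graph hcl x).inter
        (lowerSemicontinuous_iff_isClosed_preimage.1 (hg k) (v x))
    obtain ⟨u, hu⟩ := IsCompact.nonempty_iInter_of_sequence_nonempty_isCompact_isClosed K
      (fun k u hu => ⟨hu.1, (add_le_add_right (iterValue_mono k.le_succ _) _).trans hu.2⟩)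
      (fun k => by
        obtain ⟨u, hu, hmin⟩ := exists_iInf_eq (hne x) (hb.isCompact hcl x) (hg k)
        exact ⟨u, hu, hmin.le.trans (le_iSup (fun k => P.iterValue H k x) (k + 1))⟩)
      ((hb.isCompact hcl x).of_isClosed_subset (hKcl 0) fun u hu => hu.1) hKcl
    rw [mem_iInter] at hu
    refine ⟨u, (hu 0).1, ?_⟩
    rw [hv, ENNReal.add_iSup]
    exact iSup_le fun k => (hu k).2
  choose h hh hle using hgreedy
  have hcost : ∀ x, P.policyCost h x ≤ v x := P.policyCost_le h hle
  have hbest : P.bestCost H = v := by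
    funext x
    refine le_antisymm ((bestCost_le hh x).trans (hcost x)) ?_
    -- Value iteration started from zero stays below the cost of every selection, so no selection
    -- beats v.
    exact le_iInf₂ fun h' hh' => iSup_le fun k => iterValue_le_policyCost hh' k x
  refine ⟨⟨h, hh, funext fun x => le_antisymm (hbest ▸ hcost x) (bestCost_le hh x)⟩, ?_⟩
  rw [hbest]
  exact lowerSemicontinuous_iSup hlsc

/-- One step of PI⁺: what is gained by a greedy improvement of `V`. -/
theorem plus_step {σ : EuclideanSpace ℝ (Fin n) → ℝ≥0} (hσ : Continuous σ)
    {h0 : EuclideanSpace ℝ (Fin n) → EuclideanSpace ℝ (Fin m)} (hfeas : FeasibilityAssumption P σ h0)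
    {α : ℝ → ℝ} (hα : ContinuousOn α (Ici 0)) {V : EuclideanSpace ℝ (Fin n) → ℝ≥0∞}
    (hlsc : LowerSemicontinuous V) (hVα : ∀ x, V x ≤ ENNReal.ofReal (α (σ x)))
    (hV : ∀ x, ∃ u ∈ P.U x, (P.ℓ x u : ℝ≥0∞) + V (P.f x u) ≤ V x) :
    (∃ h, IsSelection (regularize (P.improve V)) h ∧
      P.policyCost h = P.bestCost (regularize (P.improve V))) ∧
    LowerSemicontinuous (P.bestCost (regularize (P.improve V))) ∧
    (∀ x, P.bestCost (regularize (P.improve V)) x ≤ V x) ∧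
    (∀ x, ∀ u ∈ P.U x, P.bestCost (regularize (P.improve V)) x ≤ P.ℓ x u + V (P.f x u)) ∧
    ∀ x, regularize (P.improve V) x ⊆ P.U x := by
  have hfin : ∀ x, V x ≠ ∞ := fun x => ne_top_of_le_ne_top ENNReal.ofReal_ne_top (hVα x)
  have hUcl := hfeas.outerSemicontinuous_U.isClosed_graph
  have hne : ∀ x, (P.improve V x).Nonempty := by
    intro x
    obtain ⟨u₀, hu₀, hle₀⟩ := hV x
    have hg := (lowerSemicontinuous_stage hfeas.continuous_f hfeas.continuous_ℓ hlsc).comp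
      (Continuous.prodMk_right x)
    obtain ⟨N, hN, B, hB, hsub⟩ := hfeas.levelBounded x (V x).toReal
    -- `P.U x` may be unbounded. Inputs outside this level set are worse than those inside, and
    -- level-boundedness makes the set compact.
    let K : Set (EuclideanSpace ℝ (Fin m)) :=
      {u | u ∈ P.U x ∧ (P.ℓ x u : ℝ≥0∞) + V (P.f x u) ≤ V x}
    have hKc : IsCompact K := by
      refine Metric.isCompact_of_isClosed_isBounded ((isClosed_of_isClosed_graph hUcl x).inter
        (lowerSemicontinuous_iff_isClosed_preimage.1 hg (V x))) (hB.subset fun u hu => ?_)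
      refine hsub x (mem_of_mem_nhds hN) ⟨hu.1, ?_⟩
      exact (ENNReal.ofReal_le_iff_le_toReal (hfin x)).1
        (by simpa using le_self_add.trans hu.2)
    obtain ⟨u, hu, hmin⟩ := exists_iInf_eq (S := K) ⟨u₀, hu₀, hle₀⟩ hKc hg
    refine ⟨u, hu.1, fun w hw => ?_⟩
    by_cases hwV : (P.ℓ x w : ℝ≥0∞) + V (P.f x w) ≤ V x
    · have hwK : w ∈ K := ⟨hw, hwV⟩
      exact hmin.le.trans (iInf₂_le w hwK)
    · exact hu.2.trans (not_le.1 hwV).le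
  have hVle : ∀ x, ∀ u ∈ P.improve V x, (P.ℓ x u : ℝ≥0∞) + V (P.f x u) ≤ V x := by
    intro x u hu
    obtain ⟨w, hw, hle⟩ := hV x
    exact (hu.2 w hw).trans hle
  have hb : IsLocallyBoundedMap (P.improve V) := by
    intro x
    have hcont : Continuous fun z => α (σ z) :=
      hα.comp_continuous (NNReal.continuous_coe.comp hσ) fun z => (σ z).2
    -- V is only lower semicontinuous, so the locally uniform level comes from its continuous
    -- majorant α ∘ σ. The maximum with 0 accounts for `ENNReal.ofReal` truncating negative values.
    obtain ⟨N, hN, B, hB, hsub⟩ := hfeas.levelBounded x (max (α (σ x) + 1) 0)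
    refine ⟨N ∩ {z | α (σ z) < α (σ x) + 1}, inter_mem hN
      ((isOpen_lt hcont continuous_const).mem_nhds (lt_add_one (α (σ x)))), B, hB, fun z hz u hu => ?_⟩
    refine hsub z hz.1 ⟨hu.1, ?_⟩
    have h1 : (P.ℓ z u : ℝ≥0∞) ≤ ENNReal.ofReal (α (σ z)) :=
      le_self_add.trans ((hVle z u hu).trans (hVα z))
    have h2 := ENNReal.toReal_mono ENNReal.ofReal_ne_top h1
    rw [ENNReal.toReal_ofReal', ENNReal.coe_toReal] at h2
    exact h2.trans (max_le_max hz.2.le le_rfl)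
  have hne' : ∀ x, (regularize (P.improve V) x).Nonempty := fun x =>
    (hne x).mono (subset_regularize x)
  obtain ⟨hatt, hlsc'⟩ := exists_policyCost_eq_bestCost hfeas.continuous_f hfeas.continuous_ℓ
    hb.regularize hne' isClosed_graph_regularize
  -- Regularized inputs need not be greedy, so the estimates use a greedy g from the unregularized
  -- map. It is also a selection of the regularized one, hence an upper bound for the best cost.
  choose g hg using hne
  have hcost := P.policyCost_le g (V := V) fun x => hVle x _ (hg x)
  have hgsel : IsSelection (regularize (P.improve V)) g := fun x => subset_regularize x (hg x)
  refine ⟨hatt, hlsc', fun x => (bestCost_le hgsel x).trans (hcost x), fun x u hu => ?_,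
    regularize_subset hfeas.outerSemicontinuous_U fun x u hu => hu.1⟩
  calc P.bestCost (regularize (P.improve V)) x ≤ P.policyCost g x := bestCost_le hgsel x
    _ = P.ℓ x (g x) + P.policyCost g (P.f x (g x)) := P.policyCost_eq g x
    _ ≤ P.ℓ x (g x) + V (P.f x (g x)) := add_le_add_right (hcost _) _
    _ ≤ _ := (hg x).2 u hu

/-- This is the invariant of the iteration: the policy attaining the current value supplies the
Bellman inequality required by the next `plus_step`. -/
theorem plusValue_spec {σ : EuclideanSpace ℝ (Fin n) → ℝ≥0} (hσ : Continuous σ)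
    {h0 : EuclideanSpace ℝ (Fin n) → EuclideanSpace ℝ (Fin m)} (hh0 : IsSelection P.U h0)
    (hfeas : FeasibilityAssumption P σ h0) {α : ℝ → ℝ} (hα : ContinuousOn α (Ici 0))
    (hV0 : ∀ x, P.policyCost h0 x ≤ ENNReal.ofReal (α (σ x))) (i : ℕ) :
    LowerSemicontinuous (P.plusValue h0 i) ∧
    (∀ x, P.plusValue h0 i x ≤ ENNReal.ofReal (α (σ x))) ∧
    ∃ h, IsSelection P.U h ∧ IsSelection (P.plusInputs h0 i) h ∧
      P.policyCost h = P.plusValue h0 i := by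
  induction i with
  | zero => exact ⟨hfeas.lowerSemicontinuous_cost, hV0, h0, hh0, fun _ => rfl, rfl⟩
  | succ i ih =>
    obtain ⟨hlsc, hle, h, hU, -, hcost⟩ := ih
    obtain ⟨⟨g, hg, hgcost⟩, h1, h2, -, h3⟩ := plus_step hσ hfeas hα hlsc hle fun x =>
      ⟨h x, hU x, by rw [← hcost, ← policyCost_eq]⟩
    exact ⟨h1, fun x => (h2 x).trans (hle x), g, fun x => h3 x (hg x), hg, hgcost⟩

theorem plusValue_succ_le {σ : EuclideanSpace ℝ (Fin n) → ℝ≥0} (hσ : Continuous σ)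
    {h0 : EuclideanSpace ℝ (Fin n) → EuclideanSpace ℝ (Fin m)} (hh0 : IsSelection P.U h0)
    (hfeas : FeasibilityAssumption P σ h0) {α : ℝ → ℝ} (hα : ContinuousOn α (Ici 0))
    (hV0 : ∀ x, P.policyCost h0 x ≤ ENNReal.ofReal (α (σ x))) (i : ℕ)
    (x : EuclideanSpace ℝ (Fin n)) {u : EuclideanSpace ℝ (Fin m)} (hu : u ∈ P.U x) :
    P.plusValue h0 (i + 1) x ≤ P.ℓ x u + P.plusValue h0 i (P.f x u) := by
  obtain ⟨hlsc, hle, h, hU, -, hcost⟩ := plusValue_spec hσ hh0 hfeas hα hV0 i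
  obtain ⟨-, -, -, h4, -⟩ := plus_step hσ hfeas hα hlsc hle fun x =>
    ⟨h x, hU x, by rw [← hcost, ← policyCost_eq]⟩
  exact h4 x u hu

/-- The error of PI⁺ is dominated by the initial error along optimal solutions. -/
theorem plusValue_sub_optValue_le (hwell : IsWellPosed P)
    {σ : EuclideanSpace ℝ (Fin n) → ℝ≥0} (hσ : Continuous σ)
    {h0 : EuclideanSpace ℝ (Fin n) → EuclideanSpace ℝ (Fin m)} (hh0 : IsSelection P.U h0)
    (hfeas : FeasibilityAssumption P σ h0) {α : ℝ → ℝ} (hα : ContinuousOn α (Ici 0))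
    (hV0 : ∀ x, P.policyCost h0 x ≤ ENNReal.ofReal (α (σ x)))
    {hstar : EuclideanSpace ℝ (Fin n) → EuclideanSpace ℝ (Fin m)}
    (hs : IsSelection P.optInputs hstar) (i : ℕ) (x : EuclideanSpace ℝ (Fin n)) :
    (P.plusValue h0 i x).toReal - (P.optValue x).toReal ≤
      (P.plusValue h0 0 (P.closedLoop hstar x i)).toReal
        - (P.optValue (P.closedLoop hstar x i)).toReal := by
  induction i generalizing x with
  | zero => exact le_rfl
  | succ i ih =>
    rw [closedLoop_succ']
    -- What remains is one step: improve with the optimal input, then subtract Bellman's equation,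
    -- which removes the stage cost.
    refine le_trans ?_ (ih _)
    have hfin : P.plusValue h0 i (P.f x (hstar x)) ≠ ∞ := ne_top_of_le_ne_top
      ENNReal.ofReal_ne_top ((plusValue_spec hσ hh0 hfeas hα hV0 i).2.1 _)
    have h1 := ENNReal.toReal_mono (ENNReal.add_ne_top.2 ⟨ENNReal.coe_ne_top, hfin⟩)
      (plusValue_succ_le hσ hh0 hfeas hα hV0 i x (hs x).1)
    rw [ENNReal.toReal_add ENNReal.coe_ne_top hfin] at h1
    have h2 := congrArg ENNReal.toReal (hwell.optValue_eq hs x)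
    rw [ENNReal.toReal_add ENNReal.coe_ne_top (hwell.optValue_ne_top _)] at h2
    linarith

end ControlProblem

/-! ### Rescaling functions of the general case. -/

section GeneralFunctions

variable {χ αW αWup αV : ℝ → ℝ}

theorem isClassKInf_qV (hχ : IsClassKInf χ) : IsClassKInf (qV χ) :=
  (hχ.comp (IsClassKInf.id.const_mul two_pos)).const_mul two_pos

theorem isClassKInf_kinv_two_mul (hχ : IsClassKInf χ) (hW : IsClassKInf αW) :
    IsClassKInf fun t => kinv αW (2 * χ t) :=
  hW.kinv.comp (hχ.const_mul two_pos)

theorem isClassKInf_theta (hχ : IsClassKInf χ) (hW : IsClassKInf αW)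
    (hc : ContinuousOn αWup (Ici 0)) (hm : MonotoneOn αWup (Ici 0)) (h0 : αWup 0 = 0) :
    IsClassKInf fun t => χ t + (αWup (kinv αW (2 * χ t)) + kinv αW (2 * χ t)) := by
  have hη := isClassKInf_kinv_two_mul hχ hW
  refine hχ.add_monotoneOn ((hc.comp hη.continuousOn hη.mapsTo).add hη.continuousOn)
    (fun s hs t ht hst => add_le_add
      (hm (hη.nonneg hs) (hη.nonneg ht) (hη.mono hs hst)) (hη.mono hs hst)) ?_
  rw [hη.map_zero, h0, add_zero]

theorem isClassKInf_qW (hχ : IsClassKInf χ) (hW : IsClassKInf αW)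
    (hc : ContinuousOn αWup (Ici 0)) (hm : MonotoneOn αWup (Ici 0)) (h0 : αWup 0 = 0) :
    IsClassKInf (qW χ αW αWup) :=
  (isClassKInf_theta hχ hW hc hm h0).kinv.const_mul one_half_pos

theorem isClassKInf_rhoV (hχ : IsClassKInf χ) : IsClassKInf (rhoV χ) :=
  (isClassKInf_qV hχ).integral

theorem isClassKInf_rhoW (hχ : IsClassKInf χ) (hW : IsClassKInf αW)
    (hc : ContinuousOn αWup (Ici 0)) (hm : MonotoneOn αWup (Ici 0)) (h0 : αWup 0 = 0) :
    IsClassKInf (rhoW χ αW αWup) :=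
  (isClassKInf_qW hχ hW hc hm h0).integral

theorem isClassKInf_alphaY (hχ : IsClassKInf χ) (hW : IsClassKInf αW)
    (hc : ContinuousOn αWup (Ici 0)) (hm : MonotoneOn αWup (Ici 0)) (h0 : αWup 0 = 0) :
    IsClassKInf (alphaY χ αW αWup) :=
  have h4 := hW.const_mul (show (0 : ℝ) < 1 / 4 by norm_num)
  ((isClassKInf_qW hχ hW hc hm h0).comp h4).mul h4

theorem isClassKInf_alphaYUp (hχ : IsClassKInf χ) (hW : IsClassKInf αW)
    (hc : ContinuousOn αWup (Ici 0)) (hm : MonotoneOn αWup (Ici 0)) (h0 : αWup 0 = 0)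
    (hV : IsClassKInf αV) : IsClassKInf (alphaYUp χ αW αWup αV) := by
  have hρ := isClassKInf_rhoW hχ hW hc hm h0
  have hmaps : MapsTo αWup (Ici 0) (Ici 0) := fun s hs => by
    simpa [h0] using hm (mem_Ici.2 le_rfl) hs hs
  refine ((isClassKInf_rhoV hχ).comp hV).add_monotoneOn (hρ.continuousOn.comp hc hmaps)
    (hρ.monotoneOn.comp hm hmaps) ?_
  rw [h0, hρ.map_zero]

theorem isClassKInf_alphaYLow (hχ : IsClassKInf χ) (hW : IsClassKInf αW)
    (hc : ContinuousOn αWup (Ici 0)) (hm : MonotoneOn αWup (Ici 0)) (h0 : αWup 0 = 0) :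
    IsClassKInf (alphaYLow χ αW αWup) :=
  have h2 := hW.const_mul one_half_pos
  ((isClassKInf_rhoV hχ).comp (hχ.kinv.comp h2)).inf
    ((isClassKInf_rhoW hχ hW hc hm h0).comp h2)

theorem continuousOn_alphaHatGen (hχ : IsClassKInf χ) (hW : IsClassKInf αW)
    (hc : ContinuousOn αWup (Ici 0)) (hV : IsClassKInf αV) :
    ContinuousOn (alphaHatGen χ αW αWup αV) (Ici 0) :=
  hV.continuousOn.sub (hχ.kinv.continuousOn.comp
    (continuousOn_const.sup (hW.continuousOn.sub hc)) fun _ _ => mem_Ici.2 (le_max_left _ _))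

/-- The value part of the Lyapunov function decreases by at least `l χ(l)` when the value
decreases by `l`. -/
theorem mul_le_rhoV_sub (hχ : IsClassKInf χ) {v l : ℝ} (hv : 0 ≤ v) (hl : 0 ≤ l) :
    l * χ l ≤ rhoV χ (l + v) - rhoV χ v := by
  have hq := isClassKInf_qV hχ
  -- On the upper half of [v, v + l], of length l/2, q_V is at least 2 χ(l); the inner factor 2 in
  -- q_V compensates for starting at l/2.
  have h1 := hq.mul_sub_le_integral_sub (show 0 ≤ v + l / 2 by linarith)
    (show v + l / 2 ≤ l + v by linarith)
  have h2 : rhoV χ v ≤ rhoV χ (v + l / 2) := (isClassKInf_rhoV hχ).mono hv (by linarith)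
  have h3 : 2 * χ l ≤ qV χ (v + l / 2) :=
    mul_le_mul_of_nonneg_left (hχ.mono hl (by linarith)) zero_le_two
  have h4 := mul_le_mul_of_nonneg_left h3 (show 0 ≤ l + v - (v + l / 2) by linarith)
  change _ ≤ rhoV χ (l + v) - rhoV χ (v + l / 2) at h1
  linarith

/-- If 2 χ(l) ≤ αW(s), then w drops by at least αW(s)/2, and ρ_W alone pays for α_Y. Otherwise s and
w are controlled by l: q_W ≤ l/2 up to w + χ(l), so ρ_W grows by at most l χ(l)/2. Also α_Y ≤ l
χ(l)/4, and the gain l χ(l) from ρ_V covers both. -/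
theorem lyapunov_decrease (hχ : IsClassKInf χ) (hW : IsClassKInf αW)
    (hc : ContinuousOn αWup (Ici 0)) (hm : MonotoneOn αWup (Ici 0)) (h0 : αWup 0 = 0)
    {s v l w w' : ℝ} (hs : 0 ≤ s) (hv : 0 ≤ v) (hl : 0 ≤ l) (hw : 0 ≤ w) (hw' : 0 ≤ w')
    (hup : w ≤ αWup s) (hdiff : w' - w ≤ -αW s + χ l) :
    rhoV χ v + rhoW χ αW αWup w' ≤
      rhoV χ (l + v) + rhoW χ αW αWup w - alphaY χ αW αWup s := by
  have hq := isClassKInf_qW hχ hW hc hm h0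
  have hρ := isClassKInf_rhoW hχ hW hc hm h0
  have hθ := isClassKInf_theta hχ hW hc hm h0
  have hV := mul_le_rhoV_sub hχ hv hl
  have hWs := hW.nonneg hs
  have hχl := hχ.nonneg hl
  have hlχ := mul_nonneg hl hχl
  rcases le_or_gt (2 * χ l) (αW s) with hcase | hcase
  · have h1 := hq.mul_sub_le_integral_sub (show 0 ≤ w - (1 / 4) * αW s by linarith)
      (show w - (1 / 4) * αW s ≤ w by linarith)
    change _ ≤ rhoW χ αW αWup w - rhoW χ αW αWup (w - (1 / 4) * αW s) at h1
    have h2 : rhoW χ αW αWup w' ≤ rhoW χ αW αWup (w - (1 / 4) * αW s) :=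
      hρ.mono hw' (by linarith)
    -- From 0 ≤ w' ≤ w - αW(s)/2 one gets w ≥ αW(s)/2, so the quarter below w still starts above
    -- αW(s)/4.
    have h3 : qW χ αW αWup ((1 / 4) * αW s) ≤ qW χ αW αWup (w - (1 / 4) * αW s) :=
      hq.mono (by linarith) (by linarith)
    have h4 := mul_le_mul_of_nonneg_right h3 (show 0 ≤ (1 / 4) * αW s by linarith)
    rw [alphaY]
    linarith
  · have hη := isClassKInf_kinv_two_mul hχ hW
    have hsη : s ≤ kinv αW (2 * χ l) := (hW.le_kinv_iff (by linarith) hs).2 hcase.le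
    have hup' : w ≤ αWup (kinv αW (2 * χ l)) := hup.trans (hm hs (hη.nonneg hl) hsη)
    have hη0 := hη.nonneg hl
    have hqθ : qW χ αW αWup (χ l + (αWup (kinv αW (2 * χ l)) + kinv αW (2 * χ l))) =
        (1 / 2) * l := by
      rw [qW, hθ.kinv_apply hl]
    have hq1 : qW χ αW αWup (w + χ l) ≤ (1 / 2) * l :=
      hqθ ▸ hq.mono (by linarith) (by linarith)
    have hq2 : qW χ αW αWup ((1 / 4) * αW s) ≤ (1 / 2) * l :=
      hqθ ▸ hq.mono (by linarith) (by linarith)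
    have h1 := hq.integral_sub_le_mul_sub hw (show w ≤ w + χ l by linarith)
    change rhoW χ αW αWup (w + χ l) - rhoW χ αW αWup w ≤ _ at h1
    have h2 : rhoW χ αW αWup w' ≤ rhoW χ αW αWup (w + χ l) := hρ.mono hw' (by linarith)
    have h3 := mul_le_mul_of_nonneg_left hq1 (show 0 ≤ w + χ l - w by linarith)
    have h4 : alphaY χ αW αWup s ≤ (1 / 2) * l * ((1 / 2) * χ l) :=
      mul_le_mul hq2 (by linarith) (by linarith) (by linarith)
    linarith

/-- By the same case split, either w ≥ αW(s)/2 or χ(l) > αW(s)/2; the two terms of the minimum match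
the two cases. -/
theorem alphaYLow_le (hχ : IsClassKInf χ) (hW : IsClassKInf αW)
    (hc : ContinuousOn αWup (Ici 0)) (hm : MonotoneOn αWup (Ici 0)) (h0 : αWup 0 = 0)
    {s v l w w' : ℝ} (hs : 0 ≤ s) (hv : 0 ≤ v) (hl : 0 ≤ l) (hw : 0 ≤ w) (hw' : 0 ≤ w')
    (hdiff : w' - w ≤ -αW s + χ l) :
    alphaYLow χ αW αWup s ≤ rhoV χ (l + v) + rhoW χ αW αWup w := by
  have hρV := isClassKInf_rhoV hχ
  have hρ := isClassKInf_rhoW hχ hW hc hm h0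
  have hWs := hW.nonneg hs
  have h1 := hρV.nonneg (add_nonneg hl hv)
  have h2 := hρ.nonneg hw
  rcases le_or_gt (2 * χ l) (αW s) with hcase | hcase
  · refine (min_le_right _ _).trans ?_
    have : rhoW χ αW αWup ((1 / 2) * αW s) ≤ rhoW χ αW αWup w :=
      hρ.mono (by linarith) (by linarith)
    linarith
  · refine (min_le_left _ _).trans ?_
    have hle : kinv χ ((1 / 2) * αW s) ≤ l :=
      (hχ.kinv_le_iff (by linarith) hl).2 (by linarith)
    have : rhoV χ (kinv χ ((1 / 2) * αW s)) ≤ rhoV χ (l + v) :=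
      hρV.mono (hχ.kinv_nonneg (by linarith)) (by linarith)
    linarith

end GeneralFunctions

/-! ### Lyapunov functions for optimal solutions and explicit bounds. -/

section Bounds

variable {n m : ℕ} {P : ControlProblem n m} {σ W : EuclideanSpace ℝ (Fin n) → ℝ≥0}
  {αW χ αWup αV : ℝ → ℝ} {hstar : EuclideanSpace ℝ (Fin n) → EuclideanSpace ℝ (Fin m)}
  {h0 : EuclideanSpace ℝ (Fin n) → EuclideanSpace ℝ (Fin m)}

theorem IsWellPosed.toReal_optValue_eq (hwell : IsWellPosed P)
    (hs : IsSelection P.optInputs hstar) (x : EuclideanSpace ℝ (Fin n)) :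
    (P.optValue x).toReal = P.ℓ x (hstar x) + (P.optValue (P.f x (hstar x))).toReal := by
  rw [hwell.optValue_eq hs x,
    ENNReal.toReal_add ENNReal.coe_ne_top (hwell.optValue_ne_top _), ENNReal.coe_toReal]

theorem toReal_optValue_le (hh0 : IsSelection P.U h0) (hαV : IsClassKInf αV)
    (hV0 : ∀ x, P.policyCost h0 x ≤ ENNReal.ofReal (αV (σ x))) (x : EuclideanSpace ℝ (Fin n)) :
    (P.optValue x).toReal ≤ αV (σ x) :=
  ENNReal.toReal_le_of_le_ofReal (hαV.nonneg (σ x).coe_nonneg)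
    ((ControlProblem.optValue_le_policyCost hh0 x).trans (hV0 x))

/-- The inequality `hle` serves twice: it bounds the initial error at the state reached after i
optimal steps, and it forces α to be positive once V⋆ differs from αV ∘ σ at points with small σ. -/
theorem IsExplicitBound.of_le (hwell : IsWellPosed P) (hσ : Continuous σ)
    (hh0 : IsSelection P.U h0) (hαV : IsClassKInf αV)
    (hV0 : ∀ x, P.policyCost h0 x ≤ ENNReal.ofReal (αV (σ x)))
    (hfeas : FeasibilityAssumption P σ h0) (hs : IsSelection P.optInputs hstar)
    {α : ℝ → ℝ} {β : ℝ → ℕ → ℝ} (hβ : IsClassKL β) (hc : ContinuousOn α (Ici 0))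
    (hm : MonotoneOn α (Ici 0)) (hz : α 0 = 0)
    (hle : ∀ x, αV (σ x) - (P.optValue x).toReal ≤ α (σ x))
    (hdecay : ∀ x k, (σ ((fun z => P.f z (hstar z))^[k] x) : ℝ) ≤ β (σ x) k) :
    IsExplicitBound P σ h0 αV α β where
  classKL := hβ
  continuousOn := hc
  monotoneOn := hm
  map_zero := hz
  pos := fun H s hs0 => by
    obtain ⟨x, hx, hne⟩ := H s hs0
    refine lt_of_lt_of_le ?_ (hm (σ x).coe_nonneg hs0.le hx)
    refine lt_of_lt_of_le (sub_pos.2 (lt_of_le_of_ne (toReal_optValue_le hh0 hαV hV0 x) ?_))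
      (hle x)
    intro heq
    exact hne (by rw [← heq, ENNReal.ofReal_toReal (hwell.optValue_ne_top x)])
  bound := fun i x => by
    refine (ControlProblem.plusValue_sub_optValue_le hwell hσ hh0 hfeas hαV.continuousOn hV0
      hs i x).trans ?_
    have h1 := hdecay x i
    rw [← P.closedLoop_eq_iterate] at h1
    have h2 : (P.plusValue h0 0 (P.closedLoop hstar x i)).toReal ≤
        αV (σ (P.closedLoop hstar x i)) :=
      ENNReal.toReal_le_of_le_ofReal (hαV.nonneg (σ _).coe_nonneg) (hV0 _)
    exact (sub_le_sub_right h2 _).trans ((hle _).trans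
      (hm (σ _).coe_nonneg (hβ.nonneg _ (σ x).coe_nonneg i) h1))

theorem isLyapunov_general (hwell : IsWellPosed P) (hdet : IsDetectable P σ W αW χ αWup)
    (hh0 : IsSelection P.U h0) (hαV : IsClassKInf αV)
    (hV0 : ∀ x, P.policyCost h0 x ≤ ENNReal.ofReal (αV (σ x)))
    (hs : IsSelection P.optInputs hstar) :
    IsLyapunov (fun z => P.f z (hstar z)) σ
      (fun x => rhoV χ (P.optValue x).toReal + rhoW χ αW αWup (W x))
      (alphaYLow χ αW αWup) (alphaY χ αW αWup) (alphaYUp χ αW αWup αV) := by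
  obtain ⟨-, hW, hχ, hc, hm, hz, hWle, hWdiff⟩ := hdet
  refine ⟨isClassKInf_alphaYLow hχ hW hc hm hz, isClassKInf_alphaY hχ hW hc hm hz,
    isClassKInf_alphaYUp hχ hW hc hm hz hαV, fun x => ?_, fun x => ?_, fun x => ?_⟩
  · rw [hwell.toReal_optValue_eq hs x]
    exact alphaYLow_le hχ hW hc hm hz (σ x).coe_nonneg ENNReal.toReal_nonneg (P.ℓ x _).coe_nonneg (W x).coe_nonneg
      (W _).coe_nonneg (hWdiff x _ (hs x).1)
  · exact add_le_add
      ((isClassKInf_rhoV hχ).mono ENNReal.toReal_nonneg (toReal_optValue_le hh0 hαV hV0 x))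
      ((isClassKInf_rhoW hχ hW hc hm hz).mono (W x).coe_nonneg (hWle x))
  · rw [hwell.toReal_optValue_eq hs x]
    exact lyapunov_decrease hχ hW hc hm hz (σ x).coe_nonneg ENNReal.toReal_nonneg (P.ℓ x _).coe_nonneg (W x).coe_nonneg
      (W _).coe_nonneg (hWle x) (hWdiff x _ (hs x).1)

/-- A Lyapunov function that is available when `χ ≤ c 𝕀`. -/
theorem isLyapunov_of_le_mul (hwell : IsWellPosed P) (hdet : IsDetectable P σ W αW χ αWup)
    (hh0 : IsSelection P.U h0) (hαV : IsClassKInf αV)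
    (hV0 : ∀ x, P.policyCost h0 x ≤ ENNReal.ofReal (αV (σ x)))
    (hs : IsSelection P.optInputs hstar) {c : ℝ} (hc : 0 < c)
    (hχ : ∀ s, 0 ≤ s → χ s ≤ c * s) {αd αup : ℝ → ℝ} (hd : IsClassKInf αd)
    (hup : IsClassKInf αup) (hdle : ∀ s, 0 ≤ s → αd s ≤ αW s / c)
    (hleup : ∀ s, 0 ≤ s → αV s + αWup s / c ≤ αup s) :
    IsLyapunov (fun z => P.f z (hstar z)) σ
      (fun x => (P.optValue x).toReal + W x / c) αd αd αup := by
  have hdec : ∀ x, (P.optValue (P.f x (hstar x))).toReal + W (P.f x (hstar x)) / c ≤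
      (P.optValue x).toReal + W x / c - αd (σ x) := by
    intro x
    rw [hwell.toReal_optValue_eq hs x]
    -- Dividing the dissipation inequality by c leaves at most one copy of ℓ, which the decrease of
    -- V⋆ cancels.
    have h1 := (hdet.W_diff_le x _ (hs x).1).trans (add_le_add_right
      (hχ (P.ℓ x (hstar x)) (P.ℓ x (hstar x)).coe_nonneg) _)
    have h2 := (div_le_div_iff_of_pos_right hc).2 h1
    rw [sub_div, add_div, neg_div, mul_div_cancel_left₀ _ hc.ne'] at h2
    linarith [hdle (σ x) (σ x).coe_nonneg]
  refine ⟨hd, hd, hup, fun x => ?_, fun x => ?_, hdec⟩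
  · have h1 : 0 ≤ (P.optValue (P.f x (hstar x))).toReal + W (P.f x (hstar x)) / c :=
      add_nonneg ENNReal.toReal_nonneg (div_nonneg (W _).coe_nonneg hc.le)
    linarith [hdec x]
  · have h1 := (div_le_div_iff_of_pos_right hc).2 (hdet.W_le x)
    linarith [hleup (σ x) (σ x).coe_nonneg, toReal_optValue_le hh0 hαV hV0 x]

/-- A linear rate of decrease gives exponential convergence. -/
theorem IsLyapunov.le_geometric {X : Type*} {F : X → X} {σ : X → ℝ≥0} {Y : X → ℝ} {a b : ℝ}
    (h : IsLyapunov F σ Y (fun s => a * s) (fun s => a * s) fun s => b * s) (ha : 0 < a)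
    (hb : 0 < b) (hab : a ≤ b) (x : X) (k : ℕ) :
    (σ (F^[k] x) : ℝ) ≤ b / a * (1 - a / b) ^ k * σ x := by
  have hr : 0 ≤ 1 - a / b := sub_nonneg.2 ((div_le_one hb).2 hab)
  have hY : Y (F^[k] x) ≤ (1 - a / b) ^ k * (b * σ x) := by
    induction k with
    | zero => simpa using h.le_up x
    | succ k ih =>
      rw [Function.iterate_succ_apply']
      have h1 := h.decrease (F^[k] x)
      have h2 : a / b * Y (F^[k] x) ≤ a * σ (F^[k] x) :=
        calc a / b * Y (F^[k] x) ≤ a / b * (b * σ (F^[k] x)) :=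
              mul_le_mul_of_nonneg_left (h.le_up _) (div_pos ha hb).le
          _ = a * σ (F^[k] x) := by field_simp
      calc Y (F (F^[k] x)) ≤ (1 - a / b) * Y (F^[k] x) := by linarith
        _ ≤ (1 - a / b) * ((1 - a / b) ^ k * (b * σ x)) := mul_le_mul_of_nonneg_left ih hr
        _ = _ := by ring
  have h3 := (h.low_le (F^[k] x)).trans hY
  rw [← mul_le_mul_iff_right₀ ha]
  refine h3.trans_eq ?_
  field_simp

theorem isClassKL_geometric {c r : ℝ} (hc : 0 ≤ c) (hr : 0 ≤ r) (hr1 : r < 1) :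
    IsClassKL fun s k => c * r ^ k * s where
  nonneg := fun s hs k => by positivity
  monotoneOn := fun k s _ t _ hst => mul_le_mul_of_nonneg_left hst (by positivity)
  antitone := fun s hs j k hjk => mul_le_mul_of_nonneg_right
    (mul_le_mul_of_nonneg_left (pow_le_pow_of_le_one hr hr1.le hjk) hc) hs
  tendsto_zero := fun k => by
    have : Continuous fun s : ℝ => c * r ^ k * s := by fun_prop
    simpa using (this.tendsto 0).mono_left nhdsWithin_le_nhds
  tendsto_atTop := fun s _ => by
    simpa using ((tendsto_pow_atTop_nhds_zero_of_lt_one hr hr1).const_mul c).mul_const s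

end Bounds

/-! ### The main theorem. -/

theorem mainTheorem3 {n m : ℕ} (hn : 0 < n) (hm : 0 < m) (P : ControlProblem n m)
    (hwell : IsWellPosed P)
    (σ : EuclideanSpace ℝ (Fin n) → ℝ≥0) (hσ : Continuous σ)
    (W : EuclideanSpace ℝ (Fin n) → ℝ≥0) (αW χ αWup : ℝ → ℝ)
    (hdet : IsDetectable P σ W αW χ αWup)
    (h0 : EuclideanSpace ℝ (Fin n) → EuclideanSpace ℝ (Fin m)) (hh0 : IsSelection P.U h0)
    (αV : ℝ → ℝ) (hαV : IsClassKInf αV)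
    (hV0 : ∀ x, P.policyCost h0 x ≤ ENNReal.ofReal (αV (σ x)))
    (hfeas : FeasibilityAssumption P σ h0) :
    -- the minimum defining each value function is attained and finite
    (∀ i x, P.plusValue h0 i x ≠ ∞ ∧
      ∃ h, IsSelection (P.plusInputs h0 i) h ∧ P.policyCost h x = P.plusValue h0 i x) ∧
    -- comparison with the initial error along optimal solutions
    (∀ hstar, IsSelection P.optInputs hstar → ∀ i x,
      (P.plusValue h0 i x).toReal - (P.optValue x).toReal ≤
        (P.plusValue h0 0 (P.closedLoop hstar x i)).toReal
          - (P.optValue (P.closedLoop hstar x i)).toReal) ∧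
    -- explicit bound, general case
    IsExplicitBound P σ h0 αV (runningMax (alphaHatGen χ αW αWup αV)) (betaGen χ αW αWup αV) ∧
    -- explicit bound when `χ ≤ 𝕀`
    ((∀ s : ℝ, 0 ≤ s → χ s ≤ s) →
      IsExplicitBound P σ h0 αV (runningMax (alphaHatSimple αW αWup αV))
        (betaSimple αW αWup αV)) ∧
    -- explicit bound under linear bounds on the comparison functions
    (∀ cW aW aV aWup : ℝ, 0 < cW → 0 < aW → 0 < aV → 0 ≤ aWup →
      (∀ s : ℝ, 0 ≤ s → χ s ≤ cW * s ∧ aW * s ≤ αW s ∧ αV s ≤ aV * s ∧ αWup s ≤ aWup * s) →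
      IsExplicitBound P σ h0 αV
        (fun s => min aV (aV + aWup / cW - aW / cW) * s)
        (fun s k => (aV + aWup / cW) / (aW / cW) *
          (1 - (aW / cW) / (aV + aWup / cW)) ^ k * s)) := by
  -- Positive state dimension makes the state space noncompact, as `decay_le_up` requires.
  have : Nonempty (Fin n) := ⟨⟨0, hn⟩⟩
  have : Nontrivial (EuclideanSpace ℝ (Fin n)) := inferInstance
  have : NoncompactSpace (EuclideanSpace ℝ (Fin n)) := NormedSpace.noncompactSpace ℝ _
  obtain ⟨hs, hsel⟩ := hwell.exists_isSelection_optInputs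
  have hW := hdet.αW_kInf
  have hχ := hdet.χ_kInf
  have hcup := hdet.αWup_continuousOn
  have hmup := hdet.αWup_monotoneOn
  have hzup := hdet.αWup_zero
  have hℓ : ∀ x, (P.ℓ x (hs x) : ℝ) ≤ (P.optValue x).toReal := fun x => by
    rw [hwell.toReal_optValue_eq hsel x]
    exact le_add_of_nonneg_right ENNReal.toReal_nonneg
  refine ⟨fun i x => ?_, fun hstar hstar' i x => ControlProblem.plusValue_sub_optValue_le hwell hσ
    hh0 hfeas hαV.continuousOn hV0 hstar' i x, ?_, fun hχ1 => ?_, ?_⟩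
  · obtain ⟨-, hle, h, -, hh, hcost⟩ :=
      ControlProblem.plusValue_spec hσ hh0 hfeas hαV.continuousOn hV0 i
    exact ⟨ne_top_of_le_ne_top ENNReal.ofReal_ne_top (hle x), h, hh, congrFun hcost x⟩
  · have hL := isLyapunov_general hwell hdet hh0 hαV hV0 hsel
    have hle := hL.decay_le_up hσ hfeas.compact_sublevel
    have hc := continuousOn_alphaHatGen hχ hW hcup hαV
    refine .of_le hwell hσ hh0 hαV hV0 hfeas hsel (isClassKL_betaFun hL.low hL.decay hL.up hle)
      (continuousOn_runningMax hc) (monotoneOn_runningMax hc) ?_ (fun x => ?_)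
      (hL.le_betaFun hle)
    · rw [runningMax_zero, alphaHatGen, hαV.map_zero, hW.map_zero, hzup, sub_zero, max_self,
        hχ.kinv.map_zero, sub_zero]
    · refine le_trans (sub_le_sub_left (le_trans ?_ (hℓ x)) _)
        (le_runningMax hc ⟨(σ x).coe_nonneg, le_rfl⟩)
      -- Detectability with W ≥ 0 at the successor gives αW(σ) - αWup(σ) ≤ χ(ℓ), and ℓ ≤ V⋆; this is
      -- the lower bound on V⋆ behind α̂.
      refine (hχ.kinv_le_iff (le_max_left _ _) (P.ℓ x _).coe_nonneg).2
        (max_le (hχ.nonneg (P.ℓ x _).coe_nonneg) ?_)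
      have h1 := hdet.W_diff_le x _ (hsel x).1
      have h2 := hdet.W_le x
      have h3 : (0 : ℝ) ≤ W (P.f x (hs x)) := (W _).coe_nonneg
      linarith
  · have hL := isLyapunov_of_le_mul hwell hdet hh0 hαV hV0 hsel one_pos
      (by simpa using hχ1) hW (hαV.add_monotoneOn hcup hmup hzup) (by simp) (by simp)
    have hle := hL.decay_le_up hσ hfeas.compact_sublevel
    have hc : ContinuousOn (alphaHatSimple αW αWup αV) (Ici 0) :=
      hαV.continuousOn.inf ((hαV.continuousOn.add hcup).sub hW.continuousOn)
    refine .of_le hwell hσ hh0 hαV hV0 hfeas hsel (isClassKL_betaFun hL.low hL.decay hL.up hle)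
      (continuousOn_runningMax hc) (monotoneOn_runningMax hc) ?_ (fun x => ?_)
      (hL.le_betaFun hle)
    · rw [runningMax_zero, alphaHatSimple, hαV.map_zero, hW.map_zero, hzup, sub_zero, add_zero,
        min_self]
    · refine le_trans (le_min ?_ ?_) (le_runningMax hc ⟨(σ x).coe_nonneg, le_rfl⟩)
      · exact sub_le_self _ ENNReal.toReal_nonneg
      -- The Lyapunov lower bound reads V⋆ ≥ αW(σ) - W, which improves on the general case.
      · have h1 := hL.low_le x
        rw [div_one] at h1
        linarith [hdet.W_le x]
  · intro cW aW aV aWup hcW haW haV haWup hlin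
    have ha : 0 < aW / cW := div_pos haW hcW
    have hb : 0 < aV + aWup / cW := add_pos_of_pos_of_nonneg haV (div_nonneg haWup hcW.le)
    have hL := isLyapunov_of_le_mul hwell hdet hh0 hαV hV0 hsel hcW (fun s hs => (hlin s hs).1)
      (IsClassKInf.id.const_mul ha) (IsClassKInf.id.const_mul hb)
      (fun s hs => by
        rw [div_mul_eq_mul_div]
        exact (div_le_div_iff_of_pos_right hcW).2 (hlin s hs).2.1)
      (fun s hs => by
        rw [add_mul, div_mul_eq_mul_div]
        exact add_le_add (hlin s hs).2.2.1
          ((div_le_div_iff_of_pos_right hcW).2 (hlin s hs).2.2.2))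
    -- Evaluation at s = 1 compares the slopes; this makes both the contraction factor and the slope
    -- of the outer function nonnegative.
    have hab : aW / cW ≤ aV + aWup / cW := by
      simpa using hL.decay_le_up hσ hfeas.compact_sublevel 1 zero_le_one
    refine .of_le hwell hσ hh0 hαV hV0 hfeas hsel
      (isClassKL_geometric (div_pos hb ha).le (sub_nonneg.2 ((div_le_one hb).2 hab))
        (sub_lt_self _ (div_pos ha hb)))
      (by fun_prop)
      (fun s _ t _ hst => mul_le_mul_of_nonneg_left hst
        (le_min haV.le (sub_nonneg.2 hab))) (mul_zero _) (fun x => ?_)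
      (hL.le_geometric ha hb hab)
    have hv : (0 : ℝ) ≤ (P.optValue x).toReal := ENNReal.toReal_nonneg
    obtain ⟨-, -, h1, h2⟩ := hlin (σ x) (σ x).coe_nonneg
    rw [min_mul_of_nonneg _ _ (σ x).coe_nonneg]
    refine le_min (by linarith) ?_
    have h3 := hL.low_le x
    have h4 := (div_le_div_iff_of_pos_right hcW).2 ((hdet.W_le x).trans h2)
    rw [← div_mul_eq_mul_div] at h4
    rw [sub_mul, add_mul]
    linarith
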